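/- Conventions: $\mathbb N=\{1,2,\dots\}$; $r'$ is the Hölder conjugate of $r\in[1,\infty]$, $\frac1r+\frac1{r'}=1$ (so $1'=\infty$); $(\Omega,\mathcal A,\mathbb P)$ is a probability space; $L^q(\Omega;E)$ is the Bochner space. A Rademacher family is a family of independent random variables $r_j$ with $\mathbb P(r_j=1)=\mathbb P(r_j=-1)=\frac12$. A real Banach space $E$ is of (Rademacher) type $p\in[1,2]$ if there is $\tau\in(0,\infty)$ such that $\bigl\|\sum_{j=1}^n r_jx_j\bigr\|_{L^p(\widetilde\Omega;E)}\le\tau\bigl(\sum_{j=1}^n\|x_j\|_E^p\bigr)^{1/p}$ for every Rademacher family on any probability space $\widetilde\Omega$, all $n\in\mathbb N$ and all $x_1,\dots,x_n\in E$; the infimum of such $\tau$ is the type $p$ constant $\tau_p(E)$. (A finite-dimensional space has every type $r\in[1,2]$.) **Theorem.** Let $p\in[1,2]$, let $E$ be a real Banach space of type $p$, and let $E_1\subseteq E_2\subseteq\dots\subseteq E$ be nested subspaces of finite dimension $N_\ell:=\dim E_\ell$. Suppose that there are $a_0,a_1\in[0,\infty)$ and $C_\tau\in[1,\infty)$ with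 $$\sup_{\ell\in\mathbb N}\ \sup_{r\in[p,2]\cap(1,2]} N_\ell^{-(a_0-a_1r')}\,[\tau_r(E_\ell)]^{r'}\le C_\tau .$$ Let $X\in L^1(\Omega;E)$, $q\in(1,\infty)\cap[p,\infty)$, $\bar q:=\min\{q,2\}$; for $\ell\in\mathbb N$ let $X_\ell\in L^q(\Omega;E_\ell)$, put $X_0:=0$ and $\xi_\ell:=X_\ell-X_{\ell-1}$, and let $\mathcal C_\ell\in[0,\infty)$ be the cost of generating one sample of $\xi_\ell$. Suppose that there are $\alpha,\beta,\gamma,C_\alpha,C_\beta,C_\gamma,c_1,c_2\in(0,\infty)$ and $A\in(1,\infty)$ such that, for all $\ell\in\mathbb N$, $c_1A^\ell\le N_\ell\le c_2A^\ell$ and $$\|\mathbb E[X]-\mathbb E[X_\ell]\|_E\le C_\alpha N_\ell^{-\alpha},\qquad \bigl\|X_\ell-\mathbb E[X_\ell]-(X_{\ell-1}-\mathbb E[X_{\ell-1}])\bigr\|_{L^q(\Omega;E)}\le C_\beta N_\ell^{-\beta},\qquad \mathcal C_\ell\le C_\gamma N_\ell^{\gamma}.$$ For each $\ell\in\mathbb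 N$ let $(\xi_{\ell,j})_{j\in\mathbb N}$ be a sequence of independent copies of $\xi_\ell$. Set $t:=\frac{\gamma+a_0}{\beta+a_1}$. Then there is a constant $K\in(0,\infty)$, depending only on $p,q,\alpha,\beta,\gamma,a_0,a_1,A,C_\tau,C_\alpha,C_\beta,C_\gamma,c_1,c_2$, such that for every $\epsilon\in(0,\frac12]$ there exist $L\in\mathbb N$ and $M_1,\dots,M_L\in\mathbb N$ with $$\Bigl\|\mathbb E[X]-\sum_{\ell=1}^L\frac1{M_\ell}\sum_{j=1}^{M_\ell}\xi_{\ell,j}\Bigr\|_{L^q(\Omega;E)}<\epsilon$$ and with total cost $$\sum_{\ell=1}^L M_\ell\,\mathcal C_\ell\ \le\ K\cdot\begin{cases} \epsilon^{-\frac\gamma\alpha}+\epsilon^{-\bar q'} & \text{if } t<\bar q',\\ \epsilon^{-\frac\gamma\alpha}+\epsilon^{-\bar q'}|\log_A\epsilon|^{\bar q'+1} & \text{if } t=\bar q',\\ \epsilon^{-\frac\gamma\alpha}+\epsilon^{-\bar q'-\frac{\gamma+a_0-(\beta+a_1)\bar q'}{\alpha}} & \text{if } t\in(\bar q',p'] \text{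 and } \alpha\ge\beta+a_1,\\ \epsilon^{-\frac\gamma\alpha}+\epsilon^{-t}|\log_A\epsilon|^{t+1} & \text{if } t\in(\bar q',p'] \text{ and } \alpha<\beta+a_1,\\ \epsilon^{-\frac\gamma\alpha}+\epsilon^{-\bar q'-\frac{\gamma+a_0-(\beta+a_1)\bar q'}{\alpha}} & \text{if } t>p' \text{ and } \alpha\ge\beta+a_1,\\ \epsilon^{-\frac\gamma\alpha}+\epsilon^{-p'-\frac{\gamma+a_0-(\beta+a_1)p'}{\alpha}} & \text{if } t>p' \text{ and } \alpha<\beta+a_1, \end{cases}$$ where for $p=1$ the condition $t\le p'=\infty$ always holds. -/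

import Mathlib

open MeasureTheory ProbabilityTheory
open scoped NNReal ENNReal

/-- A Rademacher family: independent random variables, each taking the values `1` and `-1`
with probability `1/2`. -/
structure IsRademacherFamily {ι Ω : Type*} [MeasurableSpace Ω] (P : Measure Ω)
    (r : ι → Ω → ℝ) : Prop where
  measurable : ∀ j, Measurable (r j)
  values : ∀ j ω, r j ω = 1 ∨ r j ω = -1
  indep : iIndepFun r P
  prob_one : ∀ j, P {ω | r j ω = 1} = 1 / 2
  prob_neg_one : ∀ j, P {ω | r j ω = -1} = 1 / 2

/-- `E` satisfies the type `p` inequality with constant `τ`: for every Rademacher family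
`r₁, …, rₙ` and all vectors `x₁, …, xₙ`,
`‖∑ rⱼ xⱼ‖_{L^p} ≤ τ (∑ ‖xⱼ‖^p)^{1/p}`.
All Rademacher families of length `n` have the same joint law, so the universe of the underlying
probability space is immaterial. -/
def RademacherTypeIneq (E : Type*) [NormedAddCommGroup E] [NormedSpace ℝ E]
    (p : ℝ) (τ : ℝ≥0) : Prop :=
  ∀ (Ω : Type) [MeasurableSpace Ω] (P : Measure Ω) [IsProbabilityMeasure P]
    (n : ℕ) (r : Fin n → Ω → ℝ), IsRademacherFamily P r → ∀ x : Fin n → E,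
      eLpNorm (fun ω => ∑ j, r j ω • x j) (ENNReal.ofReal p) P
        ≤ τ * (∑ j, ‖x j‖ₑ ^ p) ^ (1 / p)

/-- `E` is of Rademacher type `p`. -/
def HasRademacherType (E : Type*) [NormedAddCommGroup E] [NormedSpace ℝ E] (p : ℝ) : Prop :=
  ∃ τ : ℝ≥0, 0 < τ ∧ RademacherTypeIneq E p τ

/-- The type `p` constant `τ_p(E)`, the least admissible constant in the type `p` inequality
(with value `∞` if `E` is not of type `p`). -/
noncomputable def rademacherTypeConst (E : Type*) [NormedAddCommGroup E] [NormedSpace ℝ E]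
    (p : ℝ) : ℝ≥0∞ :=
  ⨅ (τ : ℝ≥0) (_ : 0 < τ ∧ RademacherTypeIneq E p τ), (τ : ℝ≥0∞)

/-- Growth of the type constants of the subspaces `V ℓ`, `ℓ ≥ 1`, of dimension `N_ℓ`:
`N_ℓ^{-(a₀ - a₁ r')} τ_r(V ℓ)^{r'} ≤ Cτ` for all `ℓ ≥ 1` and `r ∈ [p, 2] ∩ (1, 2]`. -/
def TypeConstGrowth {E : Type*} [NormedAddCommGroup E] [NormedSpace ℝ E]
    (V : ℕ → Submodule ℝ E) (p a₀ a₁ Cτ : ℝ) : Prop :=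
  ∀ ℓ : ℕ, 1 ≤ ℓ → ∀ r : ℝ, r ∈ Set.Icc p 2 ∩ Set.Ioc 1 2 →
    (Module.finrank ℝ (V ℓ) : ℝ≥0∞) ^ (-(a₀ - a₁ * r.conjExponent))
      * rademacherTypeConst (V ℓ) r ^ r.conjExponent ≤ ENNReal.ofReal Cτ

/-- The multilevel Monte Carlo estimator
`∑_{ℓ=1}^L (1 / M_ℓ) ∑_{j=1}^{M_ℓ} ξ_{ℓ,j}` (samples are numbered from `j = 0`). -/
noncomputable def mlmcEstimator {Ω E : Type*} [NormedAddCommGroup E] [NormedSpace ℝ E]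
    (ξ : ℕ → ℕ → Ω → E) (L : ℕ) (M : ℕ → ℕ) (ω : Ω) : E :=
  ∑ ℓ ∈ Finset.Icc 1 L, (1 / (M ℓ : ℝ)) • ∑ j ∈ Finset.range (M ℓ), ξ ℓ j ω

/-- The cost of the multilevel estimator when one sample on level `ℓ` costs `cost ℓ`. -/
noncomputable def mlmcCost (cost : ℕ → ℝ≥0) (L : ℕ) (M : ℕ → ℕ) : ℝ :=
  ∑ ℓ ∈ Finset.Icc 1 L, (M ℓ : ℝ) * (cost ℓ : ℝ)

/-- The six-case cost rate, with `t = (γ + a₀) / (β + a₁)`, `q̄ = min q 2` and `'` denoting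
Hölder conjugates. Since `1' = ∞`, the condition `t ≤ p'` reads `p = 1 ∨ t ≤ p / (p - 1)`. -/
noncomputable def mlmcRate (p q α β γ a₀ a₁ A ε : ℝ) : ℝ :=
  let t : ℝ := (γ + a₀) / (β + a₁)
  let q' : ℝ := (min q 2).conjExponent
  let p' : ℝ := p.conjExponent
  if t < q' then
    ε ^ (-(γ / α)) + ε ^ (-q')
  else if t = q' then
    ε ^ (-(γ / α)) + ε ^ (-q') * |Real.logb A ε| ^ (q' + 1)
  else if p = 1 ∨ t ≤ p' then
    if β + a₁ ≤ α then
      ε ^ (-(γ / α)) + ε ^ (-q' - (γ + a₀ - (β + a₁) * q') / α)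
    else
      ε ^ (-(γ / α)) + ε ^ (-t) * |Real.logb A ε| ^ (t + 1)
  else
    if β + a₁ ≤ α then
      ε ^ (-(γ / α)) + ε ^ (-q' - (γ + a₀ - (β + a₁) * q') / α)
    else
      ε ^ (-(γ / α)) + ε ^ (-p' - (γ + a₀ - (β + a₁) * p') / α)

/-!
Revealing the signs of a Rademacher sum `∑ r_j x_j` one at a time, the conditional expectations of
its norm form a martingale with increments at most `‖x_j‖`, so the norm has exponential moments
controlled by its mean and by `∑ ‖x_j‖ ^ 2`. Hence the type `r` inequality, which controls both,
controls every `L^q` norm. Symmetrization transfers this to independent centred summands with values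
in `E_ℓ`, so the sample mean on level `ℓ` has error of order `τ_r(E_ℓ) N_ℓ ^ (-β) M_ℓ ^ (-1 / r')`,
that is `N_ℓ ^ (-κ) M_ℓ ^ (-1 / r')` with `κ = β + a₁ - a₀ / r'` by the growth condition on the type
constants.

The finest level is chosen so that the bias is a fraction of `ε`, and the sample sizes minimize the
cost for a prescribed statistical error. The cost is then `ε ^ (-γ / α)`, caused by rounding the
sample sizes up, plus `ε ^ (-r')` times a power of a geometric sum with ratio
`A ^ ((γ - κ r') / (r' + 1))`, which is bounded, linear in the number of levels, or dominated by its
last term. Optimizing over `r` in `[p, min q 2]` gives the stated cases.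
-/

open scoped BigOperators

section Rademacher

variable {F : Type*} [NormedAddCommGroup F]

lemma expect_sign_succ {n : ℕ} (f : (Fin (n + 1) → ℤˣ) → ℝ) :
    𝔼 s, f s =
      (𝔼 s : Fin n → ℤˣ, f (Fin.cons 1 s) + 𝔼 s : Fin n → ℤˣ, f (Fin.cons (-1) s)) / 2 := by
  have hsum : ∑ s, f s = ∑ s, f (Fin.cons 1 s) + ∑ s, f (Fin.cons (-1) s) := by
    rw [← (Fin.consEquiv fun _ : Fin (n + 1) => ℤˣ).sum_comp, Fintype.sum_prod_type]
    simp [Fin.consEquiv, UnitsInt.univ]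
  simp only [Fintype.expect_eq_sum_div_card, hsum, Fintype.card_fun, Fintype.card_fin, pow_succ,
    Fintype.card_units_int, Nat.cast_mul, Nat.cast_pow, Nat.cast_ofNat, ← add_div, div_div]

lemma add_sum_cons_sign_smul {n : ℕ} (e : ℤˣ) (s : Fin n → ℤˣ) (y : F) (x : Fin (n + 1) → F) :
    y + ∑ j, (Fin.cons e s : Fin (n + 1) → ℤˣ) j • x j =
      (y + e • x 0) + ∑ j, s j • x j.succ := by
  simp [Fin.sum_univ_succ, add_assoc]

lemma abs_expect_norm_add_sub_expect_norm_add_le {ι : Type*} [Fintype ι] [Nonempty ι]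
    (y z : F) (f : ι → F) : |𝔼 i, ‖y + f i‖ - 𝔼 i, ‖z + f i‖| ≤ ‖y - z‖ := by
  rw [← Finset.expect_sub_distrib]
  refine (Finset.abs_expect_le _ _).trans (Finset.expect_le Finset.univ_nonempty fun i _ => ?_)
  simpa using abs_norm_sub_norm_le (y + f i) (z + f i)

/-- Revealing `s 0` moves the conditional expectation of the norm by at most `‖x 0‖`, and
`cosh t ≤ exp (t² / 2)` bounds the contribution of that increment. -/
lemma expect_exp_norm_sign_sum_le {n : ℕ} (l : ℝ) (y : F) (x : Fin n → F) :
    𝔼 s : Fin n → ℤˣ, Real.exp (l * ‖y + ∑ j, s j • x j‖) ≤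
      Real.exp (l * 𝔼 s : Fin n → ℤˣ, ‖y + ∑ j, s j • x j‖ + l ^ 2 * (∑ j, ‖x j‖ ^ 2) / 2) := by
  induction n generalizing y with
  | zero => simp
  | succ n ih =>
    simp only [expect_sign_succ, add_sum_cons_sign_smul, one_smul, Units.neg_smul]
    rw [Fin.sum_univ_succ]
    set S := ∑ j : Fin n, ‖x j.succ‖ ^ 2
    set a := 𝔼 s : Fin n → ℤˣ, ‖y + x 0 + ∑ j, s j • x j.succ‖
    set b := 𝔼 s : Fin n → ℤˣ, ‖y + -x 0 + ∑ j, s j • x j.succ‖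
    have increment_le : ((a - b) / 2) ^ 2 ≤ ‖x 0‖ ^ 2 := by
      have hab : |a - b| ≤ ‖(y + x 0) - (y + -x 0)‖ :=
        abs_expect_norm_add_sub_expect_norm_add_le _ _ _
      rw [show (y + x 0) - (y + -x 0) = x 0 + x 0 by abel] at hab
      rw [sq_le_sq, abs_norm, abs_div, abs_two]
      linarith [norm_add_le (x 0) (x 0)]
    calc _ ≤ (Real.exp (l * a + l ^ 2 * S / 2) + Real.exp (l * b + l ^ 2 * S / 2)) / 2 := by
          gcongr <;> exact ih _ _
      _ = Real.exp (l * ((a + b) / 2) + l ^ 2 * S / 2) * Real.cosh (l * ((a - b) / 2)) := by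
          rw [Real.cosh_eq, mul_div_assoc', mul_add, ← Real.exp_add, ← Real.exp_add]
          ring_nf
      _ ≤ Real.exp (l * ((a + b) / 2) + l ^ 2 * S / 2) *
            Real.exp ((l * ((a - b) / 2)) ^ 2 / 2) := by
          gcongr
          exact Real.cosh_le_exp_half_sq _
      _ ≤ Real.exp (l * ((a + b) / 2) + l ^ 2 * (‖x 0‖ ^ 2 + S) / 2) := by
          rw [← Real.exp_add, Real.exp_le_exp, mul_pow]
          linarith [mul_le_mul_of_nonneg_left increment_le (sq_nonneg l)]

/-- The constant by which the `L^q` norm of a Rademacher sum exceeds its first moment and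
its square function (a Kahane–Khintchine inequality). -/
noncomputable def kahaneConst (q : ℝ) : ℝ := q * Real.exp (3 / 2 / q)

lemma kahaneConst_pos {q : ℝ} (hq : 0 < q) : 0 < kahaneConst q := by
  unfold kahaneConst
  positivity

lemma expect_norm_sign_sum_rpow_le {n : ℕ} {q B : ℝ} (hq : 0 < q) (hB : 0 ≤ B) (x : Fin n → F)
    (h_mean : 𝔼 s : Fin n → ℤˣ, ‖∑ j, s j • x j‖ ≤ B) (h_sq : ∑ j, ‖x j‖ ^ 2 ≤ B ^ 2) :
    𝔼 s : Fin n → ℤˣ, ‖∑ j, s j • x j‖ ^ q ≤ (kahaneConst q * B) ^ q := by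
  rcases hB.eq_or_lt with rfl | hB
  · have hx : ∀ j, x j = 0 := fun j => by
      have := (Finset.single_le_sum (fun j _ => sq_nonneg ‖x j‖) (Finset.mem_univ j)).trans h_sq
      simpa using this
    simp [hx, Real.zero_rpow hq.ne']
  have h_exp : 𝔼 s : Fin n → ℤˣ, Real.exp (B⁻¹ * ‖∑ j, s j • x j‖) ≤ Real.exp (3 / 2) := by
    have h_main := expect_exp_norm_sign_sum_le B⁻¹ 0 x
    simp only [zero_add] at h_main
    refine h_main.trans (Real.exp_le_exp.mpr ?_)
    have h₁ : B⁻¹ * 𝔼 s : Fin n → ℤˣ, ‖∑ j, s j • x j‖ ≤ 1 := by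
      rwa [inv_mul_le_iff₀ hB, mul_one]
    have h₂ : B⁻¹ ^ 2 * ∑ j, ‖x j‖ ^ 2 ≤ 1 := by
      rwa [inv_pow, inv_mul_le_iff₀ (by positivity), mul_one]
    linarith
  calc 𝔼 s : Fin n → ℤˣ, ‖∑ j, s j • x j‖ ^ q
      ≤ 𝔼 s : Fin n → ℤˣ, (q * B) ^ q * Real.exp (B⁻¹ * ‖∑ j, s j • x j‖) := by
        refine Finset.expect_le_expect fun s _ => ?_
        simpa [abs_of_pos hB] using
          rpow_abs_le_mul_exp_abs ‖∑ j, s j • x j‖ hq.le (inv_ne_zero hB.ne')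
    _ ≤ (q * B) ^ q * Real.exp (3 / 2) := by
        rw [← Finset.mul_expect]
        gcongr
    _ = (kahaneConst q * B) ^ q := by
        rw [kahaneConst, mul_right_comm, Real.mul_rpow (x := q * B) (by positivity) (by positivity),
          ← Real.exp_mul, div_mul_cancel₀ _ hq.ne']

instance : DiscreteMeasurableSpace ℤˣ :=
  have : MeasurableSingletonClass ℤˣ :=
    ⟨fun u => ⟨{(u : ℤ)}, measurableSet_singleton _, by ext; simp [Units.ext_iff]⟩⟩
  inferInstance

/-- The joint law of `n` independent random signs, on the coordinates of which Rademacher families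
are realized. -/
noncomputable def signMeasure (n : ℕ) : Measure (Fin n → ℤˣ) :=
  Measure.pi fun _ => uniformOn Set.univ

instance (n : ℕ) : IsProbabilityMeasure (signMeasure n) := by
  unfold signMeasure
  infer_instance

lemma uniformOn_sign_singleton (e : ℤˣ) : uniformOn (Set.univ : Set ℤˣ) {e} = 1 / 2 := by
  simp [uniformOn_univ]

lemma lintegral_signMeasure {n : ℕ} (f : (Fin n → ℤˣ) → ℝ) (hf : 0 ≤ f) :
    ∫⁻ s, ENNReal.ofReal (f s) ∂signMeasure n = ENNReal.ofReal (𝔼 s, f s) := by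
  have h_singleton (s : Fin n → ℤˣ) : signMeasure n {s} = ENNReal.ofReal (1 / 2 ^ n) := by
    simp [signMeasure, Measure.pi_singleton, uniformOn_sign_singleton, ENNReal.ofReal_inv_of_pos,
      ENNReal.inv_pow]
  simp only [lintegral_fintype, h_singleton]
  rw [← Finset.sum_mul, ← ENNReal.ofReal_sum_of_nonneg fun s _ => hf s,
    ← ENNReal.ofReal_mul (Finset.sum_nonneg fun s _ => hf s)]
  simp [Fintype.expect_eq_sum_div_card, div_eq_mul_inv]

lemma isRademacherFamily_sign (n : ℕ) :
    IsRademacherFamily (signMeasure n) fun j s => ((s j : ℤ) : ℝ) := by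
  have h_marginal (j : Fin n) (e : ℤˣ) : signMeasure n {s | ((s j : ℤ) : ℝ) = (e : ℤ)} = 1 / 2 := by
    have h_eval : MeasurePreserving (fun s => s j) (signMeasure n) (uniformOn Set.univ) :=
      measurePreserving_eval _ j
    have h_preimage : {s : Fin n → ℤˣ | ((s j : ℤ) : ℝ) = (e : ℤ)} =
        (fun s => s j) ⁻¹' {e} := by
      ext
      simp [Units.ext_iff]
    rw [h_preimage, h_eval.measure_preimage (measurableSet_singleton _).nullMeasurableSet,
      uniformOn_sign_singleton]
  refine ⟨fun j => measurable_of_finite _, fun j s => ?_,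
    iIndepFun_pi (X := fun _ (e : ℤˣ) => ((e : ℤ) : ℝ)) fun _ =>
      (measurable_of_finite _).aemeasurable, fun j => ?_, fun j => ?_⟩
  · rcases Int.units_eq_one_or (s j) with h | h <;> simp [h]
  · simpa using h_marginal j 1
  · simpa using h_marginal j (-1)

lemma sum_rpow_le_rpow_sum {ι : Type*} (s : Finset ι) {p : ℝ} (hp : 1 ≤ p) {a : ι → ℝ}
    (ha : ∀ i ∈ s, 0 ≤ a i) : ∑ i ∈ s, a i ^ p ≤ (∑ i ∈ s, a i) ^ p := by
  have h_split {y : ℝ} (hy : 0 ≤ y) : y ^ p = y * y ^ (p - 1) := by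
    rw [← Real.rpow_one_add' hy (by linarith), add_sub_cancel]
  rw [h_split (Finset.sum_nonneg ha), Finset.sum_mul]
  refine Finset.sum_le_sum fun i hi => ?_
  rw [h_split (ha i hi)]
  have := ha i hi
  gcongr
  exact Finset.single_le_sum ha hi

variable [NormedSpace ℝ F]

namespace RademacherTypeIneq

variable {r q : ℝ} {τ : ℝ≥0}

lemma expect_norm_le (h : RademacherTypeIneq F r τ) (hr : 1 ≤ r) {n : ℕ} (x : Fin n → F) :
    𝔼 s : Fin n → ℤˣ, ‖∑ j, s j • x j‖ ≤ τ * (∑ j, ‖x j‖ ^ r) ^ (1 / r) := by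
  rw [← ENNReal.ofReal_le_ofReal_iff (by positivity)]
  calc ENNReal.ofReal (𝔼 s : Fin n → ℤˣ, ‖∑ j, s j • x j‖)
      = eLpNorm (fun s => ∑ j, ((s j : ℤ) : ℝ) • x j) 1 (signMeasure n) := by
        rw [← lintegral_signMeasure _ fun s => norm_nonneg _, eLpNorm_one_eq_lintegral_enorm]
        simp only [ofReal_norm, Int.cast_smul_eq_zsmul, Units.smul_def]
    _ ≤ eLpNorm (fun s => ∑ j, ((s j : ℤ) : ℝ) • x j) (ENNReal.ofReal r) (signMeasure n) :=
        eLpNorm_le_eLpNorm_of_exponent_le (by simpa using hr)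
          StronglyMeasurable.of_discrete.aestronglyMeasurable
    _ ≤ τ * (∑ j, ‖x j‖ₑ ^ r) ^ (1 / r) := h _ _ n _ (isRademacherFamily_sign n) x
    _ = ENNReal.ofReal (τ * (∑ j, ‖x j‖ ^ r) ^ (1 / r)) := by
        rw [ENNReal.ofReal_mul τ.coe_nonneg, ENNReal.ofReal_coe_nnreal,
          ← ENNReal.ofReal_rpow_of_nonneg (by positivity) (by positivity),
          ENNReal.ofReal_sum_of_nonneg fun _ _ => by positivity]
        simp only [← ofReal_norm,
          ENNReal.ofReal_rpow_of_nonneg (norm_nonneg _) (zero_le_one.trans hr)]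

lemma norm_le (h : RademacherTypeIneq F r τ) (hr : 1 ≤ r) (x : F) : ‖x‖ ≤ τ * ‖x‖ := by
  have hr₀ : r ≠ 0 := by positivity
  simpa [Real.rpow_rpow_inv (norm_nonneg x) hr₀] using h.expect_norm_le hr fun _ : Fin 1 => x

lemma expect_norm_rpow_le (h : RademacherTypeIneq F r τ) (hr : r ∈ Set.Icc 1 2) (hq : 0 < q)
    {n : ℕ} (x : Fin n → F) :
    𝔼 s : Fin n → ℤˣ, ‖∑ j, s j • x j‖ ^ q ≤
      (kahaneConst q * (τ * (∑ j, ‖x j‖ ^ r) ^ (1 / r))) ^ q := by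
  have hr₀ : 0 < r := by linarith [hr.1]
  refine expect_norm_sign_sum_rpow_le hq (by positivity) x (h.expect_norm_le hr.1 x) ?_
  calc ∑ j, ‖x j‖ ^ 2 ≤ ∑ j, (τ * ‖x j‖) ^ 2 := by
        gcongr with j
        exact h.norm_le hr.1 _
    _ = τ ^ 2 * ∑ j, (‖x j‖ ^ r) ^ (2 / r) := by
        rw [Finset.mul_sum]
        refine Finset.sum_congr rfl fun j _ => ?_
        rw [mul_pow, ← Real.rpow_mul (norm_nonneg _), mul_div_cancel₀ _ hr₀.ne', Real.rpow_two]
    _ ≤ τ ^ 2 * (∑ j, ‖x j‖ ^ r) ^ (2 / r) := by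
        gcongr
        exact sum_rpow_le_rpow_sum _ ((one_le_div hr₀).mpr hr.2) fun j _ => by positivity
    _ = (τ * (∑ j, ‖x j‖ ^ r) ^ (1 / r)) ^ 2 := by
        rw [mul_pow, ← Real.rpow_mul_natCast (by positivity)]
        push_cast
        ring_nf

end RademacherTypeIneq

end Rademacher

section Symmetrization

variable {Ω E : Type*} {mΩ : MeasurableSpace Ω} {P : Measure Ω} [NormedAddCommGroup E]

lemma stronglyMeasurable_sum_iSup_comap [MeasurableSpace E] [BorelSpace E] {ι : Type*}
    {η : ι → Ω → E} (hη : ∀ j, StronglyMeasurable (η j)) (S : Finset ι) :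
    StronglyMeasurable[⨆ j ∈ S, MeasurableSpace.comap (η j) inferInstance] (∑ j ∈ S, η j) := by
  refine Finset.stronglyMeasurable_sum _ fun j hj => ?_
  refine StronglyMeasurable.mono ?_ (le_iSup₂_of_le j hj le_rfl)
  exact (stronglyMeasurable_iff_measurable_separable
    (m := MeasurableSpace.comap (η j) inferInstance)).mpr
      ⟨comap_measurable _, (hη j).isSeparable_range⟩

variable [NormedSpace ℝ E] [CompleteSpace E]

/-- `U` is the conditional expectation of `U + W` given `U`, and conditional expectations contract
every `L^p` norm. -/
lemma eLpNorm_le_eLpNorm_add_of_indep {m₁ m₂ : MeasurableSpace Ω} (h₁ : m₁ ≤ mΩ) (h₂ : m₂ ≤ mΩ)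
    [IsFiniteMeasure P] (h_indep : Indep m₂ m₁ P) {U W : Ω → E} (hU : StronglyMeasurable[m₁] U)
    (hW : StronglyMeasurable[m₂] W) (hU_int : Integrable U P) (hW_int : Integrable W P)
    (hW_mean : ∫ ω, W ω ∂P = 0) {p : ℝ≥0∞} (hp : 1 ≤ p) :
    eLpNorm U p P ≤ eLpNorm (U + W) p P := by
  have h_condExp : P[U + W | m₁] =ᵐ[P] U := by
    filter_upwards [condExp_add hU_int hW_int m₁, condExp_indep_eq h₂ h₁ hW h_indep] with ω hadd hW'
    rw [hadd, Pi.add_apply, hW', hW_mean, add_zero, condExp_of_stronglyMeasurable h₁ hU hU_int]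
  rw [← eLpNorm_congr_ae h_condExp]
  exact eLpNorm_condExp_le_eLpNorm _ hp

variable [MeasurableSpace E] [BorelSpace E] [IsFiniteMeasure P] {ι : Type*} {η : ι → Ω → E}
  {p : ℝ≥0∞}

lemma eLpNorm_sum_le_eLpNorm_sum_sub_sum (h_indep : iIndepFun η P) (h_int : ∀ j, Integrable (η j) P)
    (h_mean : ∀ j, ∫ ω, η j ω ∂P = 0) (hp : 1 ≤ p) {S T : Finset ι} (hST : Disjoint S T) :
    eLpNorm (∑ j ∈ S, η j) p P ≤ eLpNorm (∑ j ∈ S, η j - ∑ j ∈ T, η j) p P := by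
  wlog hη : ∀ j, StronglyMeasurable (η j) generalizing η
  · have h_mk j : η j =ᵐ[P] (h_int j).1.mk := (h_int j).1.ae_eq_mk
    have h_sum (R : Finset ι) : ∑ j ∈ R, η j =ᵐ[P] ∑ j ∈ R, (h_int j).1.mk :=
      eventuallyEq_sum fun j _ => h_mk j
    rw [eLpNorm_congr_ae (h_sum S), eLpNorm_congr_ae ((h_sum S).sub (h_sum T))]
    refine this (h_indep.congr h_mk) (fun j => (h_int j).congr (h_mk j)) (fun j => ?_)
      fun j => (h_int j).1.stronglyMeasurable_mk
    rw [← h_mean j, integral_congr_ae (h_mk j)]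
  have h_le j : MeasurableSpace.comap (η j) inferInstance ≤ mΩ := (hη j).measurable.comap_le
  have h_indep' := indep_iSup_of_disjoint h_le h_indep
    (Finset.disjoint_coe.mpr hST.symm)
  have h_int_sum (R : Finset ι) : Integrable (∑ j ∈ R, η j) P :=
    integrable_finsetSum' _ fun j _ => h_int j
  rw [sub_eq_add_neg]
  refine eLpNorm_le_eLpNorm_add_of_indep (iSup₂_le fun j _ => h_le j) (iSup₂_le fun j _ => h_le j)
    h_indep' (stronglyMeasurable_sum_iSup_comap hη S) (stronglyMeasurable_sum_iSup_comap hη T).neg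
    (h_int_sum S) (h_int_sum T).neg ?_ hp
  simp only [Pi.neg_apply, Finset.sum_apply]
  rw [integral_neg, integral_finsetSum _ fun j _ => h_int j]
  simp [h_mean]

lemma eLpNorm_sum_le_two_mul_eLpNorm_sum_sign_smul [Fintype ι] (h_indep : iIndepFun η P)
    (h_int : ∀ j, Integrable (η j) P) (h_mean : ∀ j, ∫ ω, η j ω ∂P = 0) (hp : 1 ≤ p)
    (s : ι → ℤˣ) : eLpNorm (∑ j, η j) p P ≤ 2 * eLpNorm (∑ j, s j • η j) p P := by
  classical
  let S : Finset ι := {j | s j = 1}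
  have h_signed : ∑ j, s j • η j = ∑ j ∈ S, η j - ∑ j ∈ Sᶜ, η j := by
    rw [← Finset.sum_add_sum_compl S, sub_eq_add_neg, ← Finset.sum_neg_distrib]
    congr 1 <;> refine Finset.sum_congr rfl fun j hj => ?_
    · simp [(Finset.mem_filter.mp hj).2]
    · have : s j = -1 := (Int.units_eq_one_or _).resolve_left (by simpa [S] using hj)
      simp [this]
  have h_meas (R : Finset ι) : AEStronglyMeasurable (∑ j ∈ R, η j) P :=
    Finset.aestronglyMeasurable_sum _ fun j _ => (h_int j).1
  have h_le {R T : Finset ι} (hRT : Disjoint R T) :=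
    eLpNorm_sum_le_eLpNorm_sum_sub_sum h_indep h_int h_mean hp hRT
  calc eLpNorm (∑ j, η j) p P
      = eLpNorm (∑ j ∈ S, η j + ∑ j ∈ Sᶜ, η j) p P := by rw [Finset.sum_add_sum_compl]
    _ ≤ eLpNorm (∑ j ∈ S, η j) p P + eLpNorm (∑ j ∈ Sᶜ, η j) p P :=
        eLpNorm_add_le (h_meas _) (h_meas _) hp
    _ ≤ eLpNorm (∑ j ∈ S, η j - ∑ j ∈ Sᶜ, η j) p P +
          eLpNorm (∑ j ∈ Sᶜ, η j - ∑ j ∈ S, η j) p P :=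
        add_le_add (h_le disjoint_compl_right) (h_le disjoint_compl_left)
    _ = 2 * eLpNorm (∑ j, s j • η j) p P := by
        rw [eLpNorm_sub_comm _ (∑ j ∈ S, η j), h_signed, two_mul]

end Symmetrization

section IndependentSums

variable {Ω E : Type*} {mΩ : MeasurableSpace Ω} {P : Measure Ω} [NormedAddCommGroup E] {q r : ℝ}

lemma eLpNorm_ofReal_rpow (hq : 0 < q) (f : Ω → E) :
    eLpNorm f (.ofReal q) P ^ q = ∫⁻ ω, ENNReal.ofReal (‖f ω‖ ^ q) ∂P := by
  rw [eLpNorm_eq_lintegral_rpow_enorm_toReal (by simpa) ENNReal.ofReal_ne_top,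
    ENNReal.toReal_ofReal hq.le, ← ENNReal.rpow_mul, one_div_mul_cancel hq.ne', ENNReal.rpow_one]
  simp only [← ENNReal.ofReal_rpow_of_nonneg (norm_nonneg _) hq.le, ofReal_norm]

lemma exists_eLpNorm_le_of_expect_rpow_le {κ : Type*} [Fintype κ] [Nonempty κ] (hq : 0 < q)
    {g : κ → Ω → E} (hg : ∀ s, AEStronglyMeasurable (g s) P) {R : Ω → ℝ}
    (h : ∀ᵐ ω ∂P, 𝔼 s, ‖g s ω‖ ^ q ≤ ‖R ω‖ ^ q) :
    ∃ s, eLpNorm (g s) (.ofReal q) P ≤ eLpNorm R (.ofReal q) P := by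
  obtain ⟨s, hs⟩ := Finite.exists_min fun s => eLpNorm (g s) (.ofReal q) P
  refine ⟨s, (ENNReal.rpow_le_rpow_iff hq).mp ?_⟩
  suffices h_card : Fintype.card κ * eLpNorm (g s) (.ofReal q) P ^ q ≤
      Fintype.card κ * eLpNorm R (.ofReal q) P ^ q from
    (ENNReal.mul_le_mul_iff_right (by simp) (ENNReal.natCast_ne_top _)).mp h_card
  calc Fintype.card κ * eLpNorm (g s) (.ofReal q) P ^ q
      = ∑ _s' : κ, eLpNorm (g s) (.ofReal q) P ^ q := by simp
    _ ≤ ∑ s', eLpNorm (g s') (.ofReal q) P ^ q := by gcongr with s'; exact hs s'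
    _ = ∫⁻ ω, ENNReal.ofReal (∑ s', ‖g s' ω‖ ^ q) ∂P := by
        simp only [eLpNorm_ofReal_rpow hq]
        rw [← lintegral_finsetSum' _ fun s' _ =>
          ((hg s').norm.aemeasurable.pow_const q).ennreal_ofReal]
        congr with ω
        rw [ENNReal.ofReal_sum_of_nonneg fun s' _ => by positivity]
    _ ≤ ∫⁻ ω, Fintype.card κ * ENNReal.ofReal (‖R ω‖ ^ q) ∂P := by
        refine lintegral_mono_ae ?_
        filter_upwards [h] with ω hω
        rw [← Fintype.card_mul_expect, ENNReal.ofReal_mul (by positivity), ENNReal.ofReal_natCast]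
        gcongr
    _ = Fintype.card κ * eLpNorm R (.ofReal q) P ^ q := by
        rw [lintegral_const_mul' _ _ (ENNReal.natCast_ne_top _), eLpNorm_ofReal_rpow hq]

lemma eLpNorm_norm_rpow_ofReal_div (hr : 0 < r) (hq : 0 ≤ q) (f : Ω → E) :
    eLpNorm (fun ω => ‖f ω‖ ^ r) (.ofReal (q / r)) P = eLpNorm f (.ofReal q) P ^ r := by
  rw [eLpNorm_norm_rpow _ hr, ← ENNReal.ofReal_mul (by positivity), div_mul_cancel₀ _ hr.ne']

lemma eLpNorm_rpow_sum_rpow_le (hr : 0 < r) (hrq : r ≤ q) {ι : Type*} (s : Finset ι)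
    {f : ι → Ω → E} (hf : ∀ i ∈ s, AEStronglyMeasurable (f i) P) :
    eLpNorm (fun ω => (∑ i ∈ s, ‖f i ω‖ ^ r) ^ (1 / r)) (.ofReal q) P ≤
      (∑ i ∈ s, eLpNorm (f i) (.ofReal q) P ^ r) ^ (1 / r) := by
  have hq : 0 ≤ q := by linarith
  have h_norm (ω : Ω) :
      ‖(∑ i ∈ s, ‖f i ω‖ ^ r) ^ (1 / r)‖ ^ r = (∑ i ∈ s, fun ω => ‖f i ω‖ ^ r) ω := by
    rw [Real.norm_of_nonneg (by positivity), one_div, Real.rpow_inv_rpow (by positivity) hr.ne',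
      Finset.sum_apply]
  rw [one_div, ENNReal.le_rpow_inv_iff hr, ← one_div]
  simp only [← eLpNorm_norm_rpow_ofReal_div hr hq, h_norm]
  exact eLpNorm_sum_le (fun i hi => ((hf i hi).norm.aemeasurable.pow_const r).aestronglyMeasurable)
    (by simpa using (one_le_div hr).mpr hrq)

variable [NormedSpace ℝ E] [CompleteSpace E] [MeasurableSpace E] [BorelSpace E]

/-- Symmetrization reduces the claim to a pointwise application of the Rademacher moment bound. -/
lemma RademacherTypeIneq.eLpNorm_sum_le_of_iIndepFun [IsFiniteMeasure P]
    {V : Submodule ℝ E} {τ : ℝ≥0}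
    (h : RademacherTypeIneq V r τ) (hr : r ∈ Set.Icc 1 2) (hrq : r ≤ q) {n : ℕ}
    {η : Fin n → Ω → E} (h_indep : iIndepFun η P) (h_int : ∀ j, Integrable (η j) P)
    (h_mean : ∀ j, ∫ ω, η j ω ∂P = 0) (hV : ∀ j, ∀ᵐ ω ∂P, η j ω ∈ V) :
    eLpNorm (∑ j, η j) (.ofReal q) P ≤ 2 * (.ofReal (kahaneConst q * τ) *
      (∑ j, eLpNorm (η j) (.ofReal q) P ^ r) ^ (1 / r)) := by
  have hr₀ : 0 < r := by linarith [hr.1]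
  have hq : 0 < q := hr₀.trans_le hrq
  have hk := kahaneConst_pos hq
  let R : Ω → ℝ := (kahaneConst q * τ) • fun ω => (∑ j, ‖η j ω‖ ^ r) ^ (1 / r)
  have h_moment : ∀ᵐ ω ∂P, 𝔼 s : Fin n → ℤˣ, ‖(∑ j, s j • η j) ω‖ ^ q ≤ ‖R ω‖ ^ q := by
    filter_upwards [ae_all_iff.mpr hV] with ω hω
    have := h.expect_norm_rpow_le hr hq fun j => (⟨η j ω, hω j⟩ : V)
    have h_coe (s : Fin n → ℤˣ) : ‖∑ j, s j • (⟨η j ω, hω j⟩ : V)‖ = ‖(∑ j, s j • η j) ω‖ := by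
      simp [Submodule.coe_norm, Units.smul_def]
    simp only [h_coe, Submodule.coe_norm, ← mul_assoc] at this
    rwa [Real.norm_of_nonneg (by simp only [R, Pi.smul_apply, smul_eq_mul]; positivity)]
  obtain ⟨s, hs⟩ := exists_eLpNorm_le_of_expect_rpow_le hq (fun s =>
    Finset.aestronglyMeasurable_sum _ fun j _ => ((h_int j).1.const_smul (s j))) h_moment
  refine (eLpNorm_sum_le_two_mul_eLpNorm_sum_sign_smul h_indep h_int h_mean
    (by simpa using hr.1.trans hrq) s).trans ?_
  gcongr
  refine hs.trans ?_
  rw [eLpNorm_const_smul, Real.enorm_of_nonneg (by positivity)]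
  gcongr
  exact eLpNorm_rpow_sum_rpow_le hr₀ hrq _ fun j _ => (h_int j).1

lemma RademacherTypeIneq.eLpNorm_sampleMean_le [IsFiniteMeasure P]
    {V : Submodule ℝ E} {τ : ℝ≥0}
    (h : RademacherTypeIneq V r τ) (hV : MeasurableSet (V : Set E)) (hr : r ∈ Set.Icc 1 2)
    (hrq : r ≤ q) {Z : Ω → E} {ζ : ℕ → Ω → E} (hZ : Integrable Z P) (hZ_mean : ∫ ω, Z ω ∂P = 0)
    (hZV : ∀ᵐ ω ∂P, Z ω ∈ V) (h_indep : iIndepFun ζ P) (h_ident : ∀ j, IdentDistrib (ζ j) Z P P)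
    {M : ℕ} (hM : 0 < M) :
    eLpNorm ((1 / (M : ℝ)) • ∑ j ∈ Finset.range M, ζ j) (.ofReal q) P ≤
      .ofReal (2 * kahaneConst q * τ * (M : ℝ) ^ (1 / r - 1)) * eLpNorm Z (.ofReal q) P := by
  have hr₀ : 0 < r := by linarith [hr.1]
  have hk := kahaneConst_pos (hr₀.trans_le hrq)
  have hM₀ : (0 : ℝ) < M := by exact_mod_cast hM
  have h_sum := h.eLpNorm_sum_le_of_iIndepFun hr hrq (η := fun j : Fin M => ζ j)
    (h_indep.precomp Fin.val_injective) (fun j => (h_ident j).integrable_iff.mpr hZ)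
    (fun j => (h_ident j).integral_eq.trans hZ_mean)
    (fun j => (h_ident j).symm.ae_mem_snd hV hZV)
  have h_root (D : ℝ≥0∞) : (∑ _j : Fin M, D ^ r) ^ (1 / r) = .ofReal ((M : ℝ) ^ (1 / r)) * D := by
    rw [Finset.sum_const, Finset.card_univ, Fintype.card_fin, nsmul_eq_mul,
      ENNReal.mul_rpow_of_nonneg _ _ (by positivity), ← ENNReal.rpow_mul,
      mul_one_div_cancel hr₀.ne', ENNReal.rpow_one, ← ENNReal.ofReal_rpow_of_pos hM₀,
      ENNReal.ofReal_natCast]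
  simp only [fun j => (h_ident j).eLpNorm_eq (.ofReal q), h_root] at h_sum
  rw [eLpNorm_const_smul, Real.enorm_of_nonneg (by positivity),
    ← Fin.sum_univ_eq_sum_range fun j => ζ j]
  calc _ ≤ ENNReal.ofReal (1 / M) * (2 * (.ofReal (kahaneConst q * τ) *
        (.ofReal ((M : ℝ) ^ (1 / r)) * eLpNorm Z (.ofReal q) P))) := by gcongr
    _ = .ofReal (1 / M * (2 * (kahaneConst q * τ * (M : ℝ) ^ (1 / r)))) *
        eLpNorm Z (.ofReal q) P := by
        rw [ENNReal.ofReal_mul (p := 1 / M) (by positivity), ENNReal.ofReal_mul zero_le_two,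
          ENNReal.ofReal_mul (q := (M : ℝ) ^ (1 / r)) (by positivity), ENNReal.ofReal_ofNat]
        ring
    _ = _ := by
        rw [Real.rpow_sub_one hM₀.ne']
        congr 2
        ring

lemma RademacherTypeIneq.eLpNorm_integral_sub_sampleMean_le [IsProbabilityMeasure P]
    {V : Submodule ℝ E} {τ : ℝ≥0} (h : RademacherTypeIneq V r τ) (hV : IsClosed (V : Set E))
    (hr : r ∈ Set.Icc 1 2) (hrq : r ≤ q) {Z : Ω → E} {ζ : ℕ → Ω → E} (hZ : Integrable Z P)
    (hZV : ∀ᵐ ω ∂P, Z ω ∈ V) (h_indep : iIndepFun ζ P) (h_ident : ∀ j, IdentDistrib (ζ j) Z P P)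
    {M : ℕ} (hM : 0 < M) :
    eLpNorm (fun ω => (∫ ω', Z ω' ∂P) - (1 / (M : ℝ)) • ∑ j ∈ Finset.range M, ζ j ω)
        (.ofReal q) P ≤
      .ofReal (2 * kahaneConst q * τ * (M : ℝ) ^ (1 / r - 1)) *
        eLpNorm (fun ω => Z ω - ∫ ω', Z ω' ∂P) (.ofReal q) P := by
  set m := ∫ ω, Z ω ∂P
  have hm : m ∈ V := V.convex.integral_mem hV hZV hZ
  have h_shift : Measurable fun x : E => x - m := measurable_sub_const' m
  have h_error : (fun ω => m - (1 / (M : ℝ)) • ∑ j ∈ Finset.range M, ζ j ω) =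
      -((1 / (M : ℝ)) • ∑ j ∈ Finset.range M, fun ω => ζ j ω - m) := by
    have hM₀ : (M : ℝ) ≠ 0 := by exact_mod_cast hM.ne'
    ext ω
    simp only [Pi.neg_apply, Pi.smul_apply, Finset.sum_apply, Finset.sum_sub_distrib,
      Finset.sum_const, Finset.card_range, smul_sub, ← Nat.cast_smul_eq_nsmul ℝ, smul_smul,
      one_div_mul_cancel hM₀, one_smul, neg_sub]
  rw [h_error, eLpNorm_neg]
  refine h.eLpNorm_sampleMean_le hV.measurableSet hr hrq (hZ.sub (integrable_const m)) ?_ ?_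
    (h_indep.comp _ fun _ => h_shift) (fun j => (h_ident j).comp h_shift) hM
  · rw [integral_sub' hZ (integrable_const m), integral_const, probReal_univ, one_smul, sub_self]
  · filter_upwards [hZV] with ω hω using V.sub_mem hω hm

end IndependentSums

lemma TypeConstGrowth.rademacherTypeConst_le {E : Type*} [NormedAddCommGroup E]
    [NormedSpace ℝ E] {V : ℕ → Submodule ℝ E} {p a₀ a₁ Cτ r : ℝ}
    (h : TypeConstGrowth V p a₀ a₁ Cτ) (hCτ : 0 < Cτ) (hr : r ∈ Set.Icc p 2 ∩ Set.Ioc 1 2) {ℓ : ℕ}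
    (hℓ : 1 ≤ ℓ) (hN : 0 < Module.finrank ℝ (V ℓ)) :
    rademacherTypeConst (V ℓ) r ≤ .ofReal (Cτ ^ (1 / r.conjExponent) *
      (Module.finrank ℝ (V ℓ) : ℝ) ^ (a₀ / r.conjExponent - a₁)) := by
  have hs : 0 < r.conjExponent := (Real.HolderConjugate.conjExponent hr.2.1).symm.pos
  have h_growth := h ℓ hℓ r hr
  set s := r.conjExponent
  set n := Module.finrank ℝ (V ℓ)
  have hn : (0 : ℝ) < n := by exact_mod_cast hN
  have h_rpow : (Cτ ^ (1 / s) * (n : ℝ) ^ (a₀ / s - a₁)) ^ s = Cτ * (n : ℝ) ^ (a₀ - a₁ * s) := by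
    rw [Real.mul_rpow (by positivity) (by positivity), ← Real.rpow_mul hCτ.le,
      ← Real.rpow_mul hn.le, one_div_mul_cancel hs.ne', Real.rpow_one, sub_mul,
      div_mul_cancel₀ _ hs.ne']
  rw [← ENNReal.rpow_le_rpow_iff hs, ENNReal.ofReal_rpow_of_pos (by positivity), h_rpow,
    ENNReal.ofReal_mul hCτ.le, ← ENNReal.ofReal_rpow_of_pos hn, ENNReal.ofReal_natCast, mul_comm]
  rwa [ENNReal.rpow_neg, ENNReal.inv_mul_le_iff (by simp [hN.ne']) (by simp [hN.ne'])] at h_growth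

lemma exists_rademacherTypeIneq_of_rademacherTypeConst_lt {F : Type*} [NormedAddCommGroup F]
    [NormedSpace ℝ F] {r C : ℝ} (h : rademacherTypeConst F r < .ofReal C) :
    ∃ τ : ℝ≥0, RademacherTypeIneq F r τ ∧ (τ : ℝ) ≤ C := by
  simp only [rademacherTypeConst, iInf_lt_iff] at h
  obtain ⟨τ, ⟨-, hτ⟩, hτC⟩ := h
  rw [ENNReal.ofReal, ENNReal.coe_lt_coe, Real.lt_toNNReal_iff_coe_lt] at hτC
  exact ⟨τ, hτ, hτC.le⟩

section CostOptimization

variable {A α κ : ℝ}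

lemma exists_natCast_rpow_le_inv {u s : ℝ} (hu : 0 < u) (hs : 0 < s) :
    ∃ M : ℕ, 1 ≤ M ∧ (M : ℝ) ^ (-(1 / s)) ≤ u⁻¹ ∧ (M : ℝ) ≤ 1 + u ^ s := by
  have hus : 0 < u ^ s := by positivity
  refine ⟨⌈u ^ s⌉₊, Nat.ceil_pos.mpr hus, ?_, ?_⟩
  · rw [← Real.rpow_neg_one, show (-1 : ℝ) = s * -(1 / s) by field_simp, Real.rpow_mul hu.le]
    exact Real.rpow_le_rpow_of_nonpos hus (Nat.le_ceil _) (by simpa using hs.le)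
  · linarith [Nat.ceil_lt_add_one hus.le]

/-- The allocation is that of the Lagrange multiplier method: the error on level `i` is made
proportional to `(e i ^ s * c i) ^ (1 / (s + 1))`. -/
lemma exists_sampleSize_sum_le {ι : Type*} (I : Finset ι) {e c : ι → ℝ} {s ε : ℝ}
    (he : ∀ i, 0 < e i) (hc : ∀ i, 0 < c i) (hs : 0 < s) (hε : 0 < ε) :
    ∃ M : ι → ℕ, (∀ i ∈ I, 1 ≤ M i) ∧ ∑ i ∈ I, e i * (M i : ℝ) ^ (-(1 / s)) ≤ ε ∧
      ∑ i ∈ I, M i * c i ≤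
        ∑ i ∈ I, c i + ε ^ (-s) * (∑ i ∈ I, (e i ^ s * c i) ^ (1 / (s + 1))) ^ (s + 1) := by
  rcases I.eq_empty_or_nonempty with rfl | hI
  · exact ⟨0, by simp, by simpa using hε.le, by simp [Real.zero_rpow (by linarith : s + 1 ≠ 0)]⟩
  set σ := fun i => (e i ^ s * c i) ^ (1 / (s + 1)) with hσ_def
  have hec i : 0 < e i ^ s * c i := by have := he i; have := hc i; positivity
  have hσ i : 0 < σ i := Real.rpow_pos_of_pos (hec i) _
  have hσ_rpow i : σ i ^ s * σ i = e i ^ s * c i := by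
    rw [← Real.rpow_add_one (hσ i).ne', hσ_def, one_div,
      Real.rpow_inv_rpow (hec i).le (by positivity)]
  set S := ∑ i ∈ I, σ i
  have hS : 0 < S := Finset.sum_pos (fun i _ => hσ i) hI
  have hu i : 0 < e i * S / (ε * σ i) := by have := he i; have := hσ i; positivity
  choose M hM_one hM_error hM_le using fun i => exists_natCast_rpow_le_inv (hu i) hs
  refine ⟨M, fun i _ => hM_one i, ?_, ?_⟩
  · calc ∑ i ∈ I, e i * (M i : ℝ) ^ (-(1 / s)) ≤ ∑ i ∈ I, e i * (e i * S / (ε * σ i))⁻¹ := by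
          gcongr with i
          exacts [(he i).le, hM_error i]
      _ = ∑ i ∈ I, ε / S * σ i := Finset.sum_congr rfl fun i _ => by
          have := (he i).ne'
          field_simp
      _ = ε := by rw [← Finset.mul_sum, div_mul_cancel₀ _ hS.ne']
  · calc ∑ i ∈ I, M i * c i ≤ ∑ i ∈ I, (1 + (e i * S / (ε * σ i)) ^ s) * c i := by
          gcongr with i
          exacts [(hc i).le, hM_le i]
      _ = ∑ i ∈ I, (c i + ε ^ (-s) * S ^ s * σ i) := Finset.sum_congr rfl fun i _ => by
          have := hσ i
          rw [Real.div_rpow (mul_pos (he i) hS).le (by positivity), Real.mul_rpow (he i).le hS.le,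
            Real.mul_rpow hε.le this.le, Real.rpow_neg hε.le]
          field_simp
          linear_combination (-S ^ s) * hσ_rpow i
      _ = _ := by
          rw [Finset.sum_add_distrib, ← Finset.mul_sum, Real.rpow_add_one hS.ne', mul_assoc]

lemma sum_Icc_pow_le_of_lt_one {x : ℝ} (h₀ : 0 ≤ x) (h₁ : x < 1) (L : ℕ) :
    ∑ ℓ ∈ Finset.Icc 1 L, x ^ ℓ ≤ (1 - x)⁻¹ := by
  rw [← tsum_geometric_of_lt_one h₀ h₁]
  exact (summable_geometric_of_lt_one h₀ h₁).sum_le_tsum _ fun _ _ => by positivity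

lemma sum_Icc_pow_le_of_one_lt {x : ℝ} (hx : 1 < x) (L : ℕ) :
    ∑ ℓ ∈ Finset.Icc 1 L, x ^ ℓ ≤ x / (x - 1) * x ^ L := by
  have : 0 < x - 1 := by linarith
  rw [← Finset.Ico_add_one_right_eq_Icc, geom_sum_Ico hx.ne' (by lia), pow_succ,
    div_mul_eq_mul_div]
  gcongr
  linarith [pow_one x]

lemma sum_Icc_pow_rpow_le (hA : 1 < A) (hκ : 0 < κ) (L : ℕ) :
    ∑ ℓ ∈ Finset.Icc 1 L, (A ^ ℓ) ^ κ ≤ A ^ κ / (A ^ κ - 1) * (A ^ L) ^ κ := by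
  simp only [← Real.rpow_pow_comm (zero_le_one.trans hA.le) κ]
  exact sum_Icc_pow_le_of_one_lt (Real.one_lt_rpow hA hκ) L

lemma exists_pow_le_mul_rpow (hα : 0 < α) (hA : 1 < A) {H : ℝ} (hH : 0 < H) :
    ∃ K > 0, ∀ ε ∈ Set.Ioc (0 : ℝ) 1, ∃ L : ℕ, 1 ≤ L ∧
      H * (A ^ L) ^ (-α) ≤ ε ∧ A ^ L ≤ K * ε ^ (-(1 / α)) := by
  have : 0 < A := by linarith
  refine ⟨A * (1 + H ^ (1 / α)), by positivity, fun ε hε => ?_⟩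
  have hε₀ := hε.1
  have h_one : 1 ≤ ε ^ (-(1 / α)) := Real.one_le_rpow_of_pos_of_le_one_of_nonpos hε₀ hε.2
    (by simpa using hα.le)
  have hH' : 0 < H ^ (1 / α) := by positivity
  obtain ⟨n, hn_le, hn_lt⟩ :=
    exists_nat_pow_near (x := (1 + H ^ (1 / α)) * ε ^ (-(1 / α))) (by nlinarith) hA
  refine ⟨n + 1, by lia, ?_, ?_⟩
  · have h_bias : H / ε ≤ (A ^ (n + 1)) ^ α := calc
      H / ε = (H ^ (1 / α) * ε ^ (-(1 / α))) ^ α := by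
        rw [Real.mul_rpow (by positivity) (by positivity), ← Real.rpow_mul hH.le,
          ← Real.rpow_mul hε₀.le, neg_mul, one_div_mul_cancel hα.ne', Real.rpow_one,
          Real.rpow_neg_one, div_eq_mul_inv]
      _ ≤ (A ^ (n + 1)) ^ α := by
        gcongr
        nlinarith
    rw [Real.rpow_neg (by positivity), ← div_eq_mul_inv, div_le_iff₀ (by positivity)]
    rwa [div_le_iff₀' hε₀] at h_bias
  · rw [pow_succ', mul_assoc]
    gcongr

lemma exists_natCast_le_mul_abs_logb (hα : 0 < α) (hA : 1 < A) {K : ℝ} (hK : 0 < K) :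
    ∃ C > 0, ∀ ε ∈ Set.Ioc (0 : ℝ) (1 / 2), ∀ L : ℕ,
      A ^ L ≤ K * ε ^ (-α) → (L : ℝ) ≤ C * |Real.logb A ε| := by
  have h_two : 0 < Real.logb A 2 := Real.logb_pos hA one_lt_two
  refine ⟨|Real.logb A K| / Real.logb A 2 + α, by positivity, fun ε ⟨hε₀, hε₂⟩ L hL => ?_⟩
  have h_logb : Real.logb A ε ≤ -Real.logb A 2 := by
    rw [← Real.logb_inv]
    exact Real.logb_le_logb_of_le hA hε₀ (by simpa using hε₂)
  have h_abs : |Real.logb A ε| = -Real.logb A ε := abs_of_nonpos (by linarith)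
  calc (L : ℝ) = Real.logb A (A ^ L) := by rw [Real.logb_pow, Real.logb_self_eq_one hA, mul_one]
    _ ≤ Real.logb A (K * ε ^ (-α)) := Real.logb_le_logb_of_le hA (by positivity) hL
    _ = Real.logb A K + α * |Real.logb A ε| := by
        rw [Real.logb_mul hK.ne' (by positivity), Real.logb_rpow_eq_mul_logb_of_pos hε₀, h_abs]
        ring
    _ ≤ |Real.logb A K| / Real.logb A 2 * |Real.logb A ε| + α * |Real.logb A ε| := by
        gcongr
        refine (le_abs_self _).trans ?_
        rw [div_mul_eq_mul_div, le_div_iff₀ h_two]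
        gcongr
        linarith
    _ = _ := by ring

/-- The scalar data of a multilevel estimator: on level `ℓ` the bias is at most
`H₁ * (A ^ ℓ) ^ (-α)`, the statistical error with `M` samples is at most
`H₂ * (A ^ ℓ) ^ (-κ) * M ^ (-(1 / s))`, and one sample costs at most `G * (A ^ ℓ) ^ γ`. -/
structure MultilevelModel where
  (A α κ γ s H₁ H₂ G : ℝ)
  one_lt_A : 1 < A
  α_pos : 0 < α
  γ_pos : 0 < γ
  s_pos : 0 < s
  H₁_pos : 0 < H₁
  H₂_pos : 0 < H₂
  G_pos : 0 < G

namespace MultilevelModel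

/-- The bound for the error of the estimator with finest level `L` and `M ℓ` samples on level
`ℓ`. -/
noncomputable def error (m : MultilevelModel) (L : ℕ) (M : ℕ → ℕ) : ℝ :=
  m.H₁ * (m.A ^ L) ^ (-m.α) +
    ∑ ℓ ∈ Finset.Icc 1 L, m.H₂ * (m.A ^ ℓ) ^ (-m.κ) * (M ℓ : ℝ) ^ (-(1 / m.s))

/-- The bound for the cost of the estimator with finest level `L` and `M ℓ` samples on level
`ℓ`. -/
noncomputable def cost (m : MultilevelModel) (L : ℕ) (M : ℕ → ℕ) : ℝ :=
  ∑ ℓ ∈ Finset.Icc 1 L, M ℓ * (m.G * (m.A ^ ℓ) ^ m.γ)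

/-- Accuracy `ε` can be attained at a cost of order `B ε`, uniformly in `ε ∈ (0, 1/2]`. -/
def HasCostRate (m : MultilevelModel) (B : ℝ → ℝ) : Prop :=
  ∃ K > 0, ∀ ε ∈ Set.Ioc (0 : ℝ) (1 / 2), ∃ (L : ℕ) (M : ℕ → ℕ), 1 ≤ L ∧
    (∀ ℓ ∈ Finset.Icc 1 L, 1 ≤ M ℓ) ∧ m.error L M < ε ∧ m.cost L M ≤ K * B ε

variable (m : MultilevelModel)

lemma A_pos : 0 < m.A := zero_lt_one.trans m.one_lt_A

lemma exists_sampleSize_cost_le {ε : ℝ} (hε : 0 < ε) {L : ℕ}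
    (hL : 4 * m.H₁ * (m.A ^ L) ^ (-m.α) ≤ ε) :
    ∃ M : ℕ → ℕ, (∀ ℓ ∈ Finset.Icc 1 L, 1 ≤ M ℓ) ∧ m.error L M < ε ∧
      m.cost L M ≤ m.G * ∑ ℓ ∈ Finset.Icc 1 L, (m.A ^ ℓ) ^ m.γ +
        (2 * m.H₂) ^ m.s * m.G * (ε ^ (-m.s) *
          (∑ ℓ ∈ Finset.Icc 1 L, (m.A ^ ℓ) ^ ((m.γ - m.κ * m.s) / (m.s + 1))) ^ (m.s + 1)) := by
  have hA := m.A_pos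
  have hs := m.s_pos
  have hH₂ := m.H₂_pos
  have hG := m.G_pos
  obtain ⟨M, hM, h_error, h_cost⟩ := exists_sampleSize_sum_le (Finset.Icc 1 L)
    (e := fun ℓ => 2 * m.H₂ * (m.A ^ ℓ) ^ (-m.κ)) (c := fun ℓ => m.G * (m.A ^ ℓ) ^ m.γ)
    (fun ℓ => by positivity) (fun ℓ => by positivity) hs hε
  have h_weight (ℓ : ℕ) :
      ((2 * m.H₂ * (m.A ^ ℓ) ^ (-m.κ)) ^ m.s * (m.G * (m.A ^ ℓ) ^ m.γ)) ^ (1 / (m.s + 1)) =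
      ((2 * m.H₂) ^ m.s * m.G) ^ (1 / (m.s + 1)) *
        (m.A ^ ℓ) ^ ((m.γ - m.κ * m.s) / (m.s + 1)) := by
    rw [Real.mul_rpow (x := 2 * m.H₂) (by positivity) (by positivity), mul_mul_mul_comm,
      Real.mul_rpow (by positivity) (by positivity), ← Real.rpow_mul (by positivity),
      ← Real.rpow_add (by positivity), ← Real.rpow_mul (by positivity)]
    ring_nf
  refine ⟨M, hM, ?_, ?_⟩
  · simp only [mul_assoc, ← Finset.mul_sum] at h_error hL
    simp only [error, mul_assoc, ← Finset.mul_sum]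
    linarith
  · simp only [h_weight, ← Finset.mul_sum] at h_cost
    rw [Real.mul_rpow (by positivity) (by positivity), one_div,
      Real.rpow_inv_rpow (by positivity) (by positivity)] at h_cost
    simpa only [cost, mul_left_comm] using h_cost

lemma exists_cost_le : ∃ K > 0, ∀ ε ∈ Set.Ioc (0 : ℝ) (1 / 2), ∃ (L : ℕ) (M : ℕ → ℕ),
    1 ≤ L ∧ (∀ ℓ ∈ Finset.Icc 1 L, 1 ≤ M ℓ) ∧ m.error L M < ε ∧
      m.A ^ L ≤ K * ε ^ (-(1 / m.α)) ∧
      m.cost L M ≤ K * (ε ^ (-(m.γ / m.α)) + ε ^ (-m.s) *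
        (∑ ℓ ∈ Finset.Icc 1 L, (m.A ^ ℓ) ^ ((m.γ - m.κ * m.s) / (m.s + 1))) ^ (m.s + 1)) := by
  have hA := m.A_pos
  have hH₁ := m.H₁_pos
  have hH₂ := m.H₂_pos
  have hG := m.G_pos
  have hAγ : 0 < m.A ^ m.γ - 1 := sub_pos.mpr (Real.one_lt_rpow m.one_lt_A m.γ_pos)
  obtain ⟨K₀, hK₀, h_level⟩ :=
    exists_pow_le_mul_rpow m.α_pos m.one_lt_A (show 0 < 4 * m.H₁ by positivity)
  set K₁ := m.G * (m.A ^ m.γ / (m.A ^ m.γ - 1) * K₀ ^ m.γ) with hK₁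
  set K₂ := (2 * m.H₂) ^ m.s * m.G
  have hK₁_pos : 0 < K₁ := by positivity
  have hK₂_pos : 0 < K₂ := by positivity
  refine ⟨K₀ + K₁ + K₂, by positivity, fun ε hε => ?_⟩
  have hε₀ := hε.1
  obtain ⟨L, hL, h_bias, hAL⟩ := h_level ε ⟨hε₀, by linarith [hε.2]⟩
  obtain ⟨M, hM, h_error, h_cost⟩ := m.exists_sampleSize_cost_le hε₀ h_bias
  have h_single : m.G * ∑ ℓ ∈ Finset.Icc 1 L, (m.A ^ ℓ) ^ m.γ ≤ K₁ * ε ^ (-(m.γ / m.α)) := calc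
    _ ≤ m.G * (m.A ^ m.γ / (m.A ^ m.γ - 1) * (K₀ * ε ^ (-(1 / m.α))) ^ m.γ) := by
      have := m.γ_pos
      grw [sum_Icc_pow_rpow_le m.one_lt_A m.γ_pos, hAL]
    _ = _ := by
      rw [Real.mul_rpow hK₀.le (by positivity), ← Real.rpow_mul hε₀.le, hK₁]
      ring_nf
  refine ⟨L, M, hL, hM, h_error, hAL.trans (by gcongr; linarith), h_cost.trans ?_⟩
  rw [mul_add]
  refine add_le_add (h_single.trans ?_) ?_ <;> gcongr <;> linarith

lemma hasCostRate_of_sum_rpow_le {R : ℝ → ℝ}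
    (h : ∀ K > 0, ∃ C > 0, ∀ ε ∈ Set.Ioc (0 : ℝ) (1 / 2), ∀ L : ℕ,
      m.A ^ L ≤ K * ε ^ (-(1 / m.α)) → ε ^ (-m.s) *
        (∑ ℓ ∈ Finset.Icc 1 L, (m.A ^ ℓ) ^ ((m.γ - m.κ * m.s) / (m.s + 1))) ^ (m.s + 1) ≤
          C * R ε) :
    m.HasCostRate fun ε => ε ^ (-(m.γ / m.α)) + R ε := by
  have hA := m.A_pos
  obtain ⟨K, hK, h_cost⟩ := m.exists_cost_le
  obtain ⟨C, hC, h_sum⟩ := h K hK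
  refine ⟨K * (1 + C), by positivity, fun ε hε => ?_⟩
  obtain ⟨L, M, hL, hM, h_error, hAL, h_le⟩ := h_cost ε hε
  have hε₀ := hε.1
  replace h_sum := h_sum ε hε L hAL
  have hR : 0 ≤ R ε := nonneg_of_mul_nonneg_right (le_trans (by positivity) h_sum) hC
  have h_single : 0 ≤ C * ε ^ (-(m.γ / m.α)) := by positivity
  refine ⟨L, M, hL, hM, h_error, h_le.trans ?_⟩
  rw [mul_assoc]
  gcongr
  linarith

lemma hasCostRate_of_lt (h : m.γ < m.κ * m.s) :
    m.HasCostRate fun ε => ε ^ (-(m.γ / m.α)) + ε ^ (-m.s) := by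
  have hA := m.A_pos
  have hs := m.s_pos
  refine m.hasCostRate_of_sum_rpow_le fun _ _ => ?_
  set e := (m.γ - m.κ * m.s) / (m.s + 1)
  have hAe : m.A ^ e < 1 := Real.rpow_lt_one_of_one_lt_of_neg m.one_lt_A
    (div_neg_of_neg_of_pos (by linarith) (by positivity))
  have hAe' : 0 < 1 - m.A ^ e := by linarith
  refine ⟨(1 - m.A ^ e)⁻¹ ^ (m.s + 1), by positivity, fun ε hε L _ => ?_⟩
  have hε₀ := hε.1
  rw [mul_comm]
  simp only [← Real.rpow_pow_comm hA.le e]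
  gcongr
  exact sum_Icc_pow_le_of_lt_one (by positivity) hAe L

lemma hasCostRate_of_eq (h : m.γ = m.κ * m.s) :
    m.HasCostRate fun ε =>
      ε ^ (-(m.γ / m.α)) + ε ^ (-m.s) * |Real.logb m.A ε| ^ (m.s + 1) := by
  have hα := m.α_pos
  have hs := m.s_pos
  refine m.hasCostRate_of_sum_rpow_le fun K hK => ?_
  obtain ⟨C, hC, h_log⟩ :=
    exists_natCast_le_mul_abs_logb (show 0 < 1 / m.α by positivity) m.one_lt_A hK
  refine ⟨C ^ (m.s + 1), by positivity, fun ε hε L hAL => ?_⟩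
  have hε₀ := hε.1
  rw [mul_left_comm, ← Real.mul_rpow hC.le (abs_nonneg _)]
  simp only [h, sub_self, zero_div, Real.rpow_zero, Finset.sum_const, Nat.card_Icc,
    add_tsub_cancel_right, nsmul_one]
  gcongr
  exact h_log ε hε L hAL

lemma hasCostRate_of_gt (h : m.κ * m.s < m.γ) :
    m.HasCostRate fun ε =>
      ε ^ (-(m.γ / m.α)) + ε ^ (-m.s - (m.γ - m.κ * m.s) / m.α) := by
  have hA := m.A_pos
  have hs := m.s_pos
  refine m.hasCostRate_of_sum_rpow_le fun K hK => ?_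
  set δ := m.γ - m.κ * m.s
  have hδ : 0 < δ := by linarith
  set c := m.A ^ (δ / (m.s + 1)) / (m.A ^ (δ / (m.s + 1)) - 1)
  have hc : 0 < c := div_pos (by positivity)
    (sub_pos.mpr (Real.one_lt_rpow m.one_lt_A (by positivity)))
  refine ⟨c ^ (m.s + 1) * K ^ δ, by positivity, fun ε hε L hAL => ?_⟩
  have hε₀ := hε.1
  calc _ ≤ ε ^ (-m.s) * (c * (m.A ^ L) ^ (δ / (m.s + 1))) ^ (m.s + 1) := by
        gcongr
        exact sum_Icc_pow_rpow_le m.one_lt_A (by positivity) L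
    _ = ε ^ (-m.s) * (c ^ (m.s + 1) * (m.A ^ L) ^ δ) := by
        rw [Real.mul_rpow hc.le (by positivity), ← Real.rpow_mul (by positivity),
          div_mul_cancel₀ _ (by positivity)]
    _ ≤ ε ^ (-m.s) * (c ^ (m.s + 1) * (K * ε ^ (-(1 / m.α))) ^ δ) := by gcongr
    _ = _ := by
        rw [Real.mul_rpow hK.le (by positivity), ← Real.rpow_mul hε₀.le, sub_eq_add_neg (-m.s),
          Real.rpow_add hε₀]
        ring_nf

end MultilevelModel

end CostOptimization

section TypeExponent

lemma conjExponent_le_comm {x y : ℝ} (hx : 1 < x) (hy : 1 < y) :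
    x.conjExponent ≤ y ↔ y.conjExponent ≤ x := by
  rw [Real.conjExponent, Real.conjExponent, div_le_iff₀ (by linarith), div_le_iff₀ (by linarith)]
  constructor <;> intro <;> linarith

lemma le_conjExponent_comm {x y : ℝ} (hx : 1 < x) (hy : 1 < y) :
    x ≤ y.conjExponent ↔ y ≤ x.conjExponent := by
  rw [Real.conjExponent, Real.conjExponent, le_div_iff₀ (by linarith), le_div_iff₀ (by linarith)]
  constructor <;> intro <;> linarith

/-- The exponent `r` for which using the type `r` constants of the subspaces leads to the smallest
cost, where `t = (γ + a₀) / (β + a₁)` and `b = β + a₁`. If neither a small `t` nor the decay of the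
bias makes the largest admissible exponent `min q 2` optimal, then `r' = t` is the best choice, or
`r = p` when `t` is out of reach. -/
noncomputable def optimalTypeExponent (p q α b t : ℝ) : ℝ :=
  if t ≤ (min q 2).conjExponent ∨ b ≤ α then min q 2
  else if p = 1 ∨ t ≤ p.conjExponent then t.conjExponent
  else p

lemma optimalTypeExponent_mem_Icc {p q α b t : ℝ} (hp : p ∈ Set.Icc 1 2) (hq : 1 < q)
    (hpq : p ≤ q) : optimalTypeExponent p q α b t ∈ Set.Icc p (min q 2) := by
  have hpq₂ : p ≤ min q 2 := le_min hpq hp.2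
  have hq₂ : 1 < min q 2 := lt_min hq one_lt_two
  unfold optimalTypeExponent
  split_ifs with h_large h_conj
  · exact ⟨hpq₂, le_rfl⟩
  · have htq : (min q 2).conjExponent < t := not_le.mp (not_or.mp h_large).1
    have ht : 1 < t := (Real.HolderConjugate.conjExponent hq₂).symm.lt.trans htq
    refine ⟨?_, (conjExponent_le_comm hq₂ ht).mp htq.le⟩
    rcases hp.1.eq_or_lt with rfl | hp₁
    · exact (Real.HolderConjugate.conjExponent ht).symm.lt.le
    · exact (le_conjExponent_comm ht hp₁).mp (h_conj.resolve_left hp₁.ne')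
  · exact ⟨le_rfl, hpq₂⟩

lemma one_lt_optimalTypeExponent {p q α b t : ℝ} (hp : 1 ≤ p) (hq : 1 < q) :
    1 < optimalTypeExponent p q α b t := by
  have hq₂ : 1 < min q 2 := lt_min hq one_lt_two
  unfold optimalTypeExponent
  split_ifs with h_large h_conj
  · exact hq₂
  · have htq : (min q 2).conjExponent < t := not_le.mp (not_or.mp h_large).1
    exact (Real.HolderConjugate.conjExponent
      ((Real.HolderConjugate.conjExponent hq₂).symm.lt.trans htq)).symm.lt
  · exact lt_of_le_of_ne hp (Ne.symm (not_or.mp h_conj).1)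

lemma conjExponent_optimalTypeExponent {p q α b t : ℝ} (hq : 1 < q) :
    (optimalTypeExponent p q α b t).conjExponent =
      if t ≤ (min q 2).conjExponent ∨ b ≤ α then (min q 2).conjExponent
      else if p = 1 ∨ t ≤ p.conjExponent then t
      else p.conjExponent := by
  have hq₂ : 1 < min q 2 := lt_min hq one_lt_two
  unfold optimalTypeExponent
  split_ifs with h_large h_conj
  · rfl
  · have htq : (min q 2).conjExponent < t := not_le.mp (not_or.mp h_large).1
    exact (Real.HolderConjugate.conjExponent
      ((Real.HolderConjugate.conjExponent hq₂).symm.lt.trans htq)).symm.conjExponent_eq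
  · rfl

lemma MultilevelModel.hasCostRate_mlmcRate (m : MultilevelModel) {p q β a₀ a₁ : ℝ}
    (hq : 1 < q) (hb : 0 < β + a₁) (hκ : m.κ = β + a₁ - a₀ / m.s)
    (hs : m.s =
      (optimalTypeExponent p q m.α (β + a₁) ((m.γ + a₀) / (β + a₁))).conjExponent) :
    m.HasCostRate (mlmcRate p q m.α β m.γ a₀ a₁ m.A) := by
  unfold mlmcRate
  dsimp only
  rw [conjExponent_optimalTypeExponent hq] at hs
  set t := (m.γ + a₀) / (β + a₁)
  set q' := (min q 2).conjExponent
  have hbt : (β + a₁) * t = m.γ + a₀ := mul_div_cancel₀ _ hb.ne'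
  have hκs : m.κ * m.s = (β + a₁) * m.s - a₀ := by
    rw [hκ, sub_mul, div_mul_cancel₀ _ m.s_pos.ne']
  have h_rate_of_gt (h : m.s < t) : m.HasCostRate fun ε =>
      ε ^ (-(m.γ / m.α)) + ε ^ (-m.s - (m.γ + a₀ - (β + a₁) * m.s) / m.α) := by
    convert! m.hasCostRate_of_gt (by nlinarith) using 5
    rw [hκs]
    ring
  have h_rate_of_eq (h : t = m.s) := m.hasCostRate_of_eq (by rw [hκs, ← h, hbt]; ring)
  split_ifs with h_lt h_eq h_le_p' hbα hbα
  · rw [if_pos (.inl h_lt.le)] at hs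
    rw [← hs] at h_lt ⊢
    exact m.hasCostRate_of_lt (by nlinarith)
  · rw [if_pos (.inl h_eq.le)] at hs
    rw [← hs] at h_eq ⊢
    exact h_rate_of_eq h_eq
  all_goals have h_gt : q' < t := lt_of_le_of_ne (not_lt.mp h_lt) (Ne.symm h_eq)
  · rw [if_pos (.inr hbα)] at hs
    rw [← hs] at h_gt ⊢
    exact h_rate_of_gt h_gt
  · rw [if_neg (by simp [h_gt, hbα]), if_pos h_le_p'] at hs
    rw [← hs]
    exact h_rate_of_eq hs.symm
  · rw [if_pos (.inr hbα)] at hs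
    rw [← hs] at h_gt ⊢
    exact h_rate_of_gt h_gt
  · rw [if_neg (by simp [h_gt, hbα]), if_neg h_le_p'] at hs
    rw [← hs] at h_le_p' ⊢
    exact h_rate_of_gt (not_le.mp (not_or.mp h_le_p').2)

end TypeExponent

lemma rpow_le_add_mul_rpow {c₁ c₂ a x : ℝ} (hc₁ : 0 < c₁) (ha : 0 < a)
    (hx : c₁ * a ≤ x ∧ x ≤ c₂ * a) (e : ℝ) : x ^ e ≤ (c₁ ^ e + c₂ ^ e) * a ^ e := by
  have hx₀ : 0 < x := (mul_pos hc₁ ha).trans_le hx.1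
  have hc₂ : 0 < c₂ := pos_of_mul_pos_left (hx₀.trans_le hx.2) ha.le
  rw [add_mul, ← Real.mul_rpow hc₁.le ha.le, ← Real.mul_rpow hc₂.le ha.le]
  rcases le_total 0 e with he | he
  · exact (Real.rpow_le_rpow hx₀.le hx.2 he).trans (le_add_of_nonneg_left (by positivity))
  · exact (Real.rpow_le_rpow_of_nonpos (by positivity) hx.1 he).trans
      (le_add_of_nonneg_right (by positivity))

section Estimator

variable {Ω E : Type*} [MeasurableSpace Ω] {P : Measure Ω} [NormedAddCommGroup E]
  [NormedSpace ℝ E] {Y : ℕ → Ω → E}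

lemma sum_Icc_sub_pred {G : Type*} [AddCommGroup G] (f : ℕ → G) (L : ℕ) :
    ∑ ℓ ∈ Finset.Icc 1 L, (f ℓ - f (ℓ - 1)) = f L - f 0 := by
  induction L with
  | zero => simp
  | succ n ih => rw [Finset.sum_Icc_succ_top (by lia), ih, add_tsub_cancel_right, add_comm,
      sub_add_sub_cancel]

lemma ae_sub_pred_mem {V : ℕ → Submodule ℝ E} (hV : ∀ ℓ, 1 ≤ ℓ → V ℓ ≤ V (ℓ + 1))
    (hY₀ : Y 0 = 0) (hY : ∀ ℓ, 1 ≤ ℓ → ∀ᵐ ω ∂P, Y ℓ ω ∈ V ℓ) {ℓ : ℕ} (hℓ : 1 ≤ ℓ) :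
    ∀ᵐ ω ∂P, Y ℓ ω - Y (ℓ - 1) ω ∈ V ℓ := by
  obtain ⟨k, rfl⟩ := Nat.exists_eq_add_of_le' hℓ
  rcases Nat.eq_zero_or_pos k with rfl | hk
  · simpa [hY₀] using hY 1 le_rfl
  · filter_upwards [hY (k + 1) hℓ, hY k hk] with ω h_succ h_pred
    exact (V (k + 1)).sub_mem h_succ (hV k hk h_pred)

variable [IsProbabilityMeasure P]

lemma eLpNorm_sub_mlmcEstimator_le {p : ℝ≥0∞} (hp : 1 ≤ p) (x : E) (hY₀ : Y 0 = 0)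
    (hY : ∀ ℓ, Integrable (Y ℓ) P) {ξ : ℕ → ℕ → Ω → E} {L : ℕ} (M : ℕ → ℕ)
    (hξ : ∀ ℓ ∈ Finset.Icc 1 L, ∀ j, AEStronglyMeasurable (ξ ℓ j) P) :
    eLpNorm (fun ω => x - mlmcEstimator ξ L M ω) p P ≤
      ‖x - ∫ ω, Y L ω ∂P‖ₑ + ∑ ℓ ∈ Finset.Icc 1 L,
        eLpNorm (fun ω => (∫ ω', (Y ℓ ω' - Y (ℓ - 1) ω') ∂P) -
          (1 / (M ℓ : ℝ)) • ∑ j ∈ Finset.range (M ℓ), ξ ℓ j ω) p P := by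
  set d : ℕ → Ω → E := fun ℓ ω => (∫ ω', (Y ℓ ω' - Y (ℓ - 1) ω') ∂P) -
    (1 / (M ℓ : ℝ)) • ∑ j ∈ Finset.range (M ℓ), ξ ℓ j ω with hd_def
  have hd : ∀ ℓ ∈ Finset.Icc 1 L, AEStronglyMeasurable (d ℓ) P := fun ℓ hℓ =>
    aestronglyMeasurable_const.sub
      ((Finset.aestronglyMeasurable_fun_sum _ fun j _ => hξ ℓ hℓ j).const_smul _)
  have h_telescope :
      ∑ ℓ ∈ Finset.Icc 1 L, ∫ ω, (Y ℓ ω - Y (ℓ - 1) ω) ∂P = ∫ ω, Y L ω ∂P := by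
    simp only [fun ℓ => integral_sub (hY ℓ) (hY (ℓ - 1)),
      sum_Icc_sub_pred fun ℓ => ∫ ω, Y ℓ ω ∂P, hY₀, Pi.zero_apply, integral_zero, sub_zero]
  have h_split : (fun ω => x - mlmcEstimator ξ L M ω) =
      (fun _ => x - ∫ ω, Y L ω ∂P) + ∑ ℓ ∈ Finset.Icc 1 L, d ℓ := by
    ext ω
    simp only [Pi.add_apply, Finset.sum_apply, hd_def, Finset.sum_sub_distrib, h_telescope,
      mlmcEstimator, sub_add_sub_cancel]
  rw [h_split]
  refine (eLpNorm_add_le aestronglyMeasurable_const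
    (Finset.aestronglyMeasurable_sum _ hd) hp).trans (add_le_add ?_ (eLpNorm_sum_le hd hp))
  rw [eLpNorm_const _ (by positivity) (IsProbabilityMeasure.ne_zero P), measure_univ,
    ENNReal.one_rpow, mul_one]

lemma MultilevelModel.eLpNorm_sub_mlmcEstimator_le (m : MultilevelModel) {p : ℝ≥0∞} (hp : 1 ≤ p)
    {x : E} (hY₀ : Y 0 = 0) (hY : ∀ ℓ, Integrable (Y ℓ) P) {ξ : ℕ → ℕ → Ω → E} {L : ℕ}
    {M : ℕ → ℕ} (hξ : ∀ ℓ ∈ Finset.Icc 1 L, ∀ j, AEStronglyMeasurable (ξ ℓ j) P)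
    (h_bias : ‖x - ∫ ω, Y L ω ∂P‖ ≤ m.H₁ * (m.A ^ L) ^ (-m.α))
    (h_level : ∀ ℓ ∈ Finset.Icc 1 L,
      eLpNorm (fun ω => (∫ ω', (Y ℓ ω' - Y (ℓ - 1) ω') ∂P) -
        (1 / (M ℓ : ℝ)) • ∑ j ∈ Finset.range (M ℓ), ξ ℓ j ω) p P ≤
          .ofReal (m.H₂ * (m.A ^ ℓ) ^ (-m.κ) * (M ℓ : ℝ) ^ (-(1 / m.s)))) :
    eLpNorm (fun ω => x - mlmcEstimator ξ L M ω) p P ≤ .ofReal (m.error L M) := by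
  have hA := m.A_pos
  have hH₂ := m.H₂_pos
  rw [MultilevelModel.error, ENNReal.ofReal_add ((norm_nonneg _).trans h_bias) (by positivity),
    ENNReal.ofReal_sum_of_nonneg fun ℓ _ => by positivity]
  refine (_root_.eLpNorm_sub_mlmcEstimator_le hp x hY₀ hY M hξ).trans
    (add_le_add ?_ (Finset.sum_le_sum h_level))
  rw [← ofReal_norm]
  exact ENNReal.ofReal_le_ofReal h_bias

variable [CompleteSpace E] [MeasurableSpace E] [BorelSpace E] {q r : ℝ}

lemma eLpNorm_integral_sub_sampleMean_le_of_rademacherTypeConst_le {V : Submodule ℝ E} {T : ℝ}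
    (h : rademacherTypeConst V r ≤ .ofReal T) (hT : 0 < T) (hV : IsClosed (V : Set E))
    (hr : r ∈ Set.Ioc 1 2) (hrq : r ≤ q) {Z : Ω → E} {ζ : ℕ → Ω → E} (hZ : Integrable Z P)
    (hZV : ∀ᵐ ω ∂P, Z ω ∈ V) (h_indep : iIndepFun ζ P) (h_ident : ∀ j, IdentDistrib (ζ j) Z P P)
    {M : ℕ} (hM : 0 < M) :
    eLpNorm (fun ω => (∫ ω', Z ω' ∂P) - (1 / (M : ℝ)) • ∑ j ∈ Finset.range M, ζ j ω)
        (.ofReal q) P ≤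
      .ofReal (4 * kahaneConst q * T * (M : ℝ) ^ (-(1 / r.conjExponent))) *
        eLpNorm (fun ω => Z ω - ∫ ω', Z ω' ∂P) (.ofReal q) P := by
  have hk := kahaneConst_pos (show 0 < q by linarith [hr.1])
  obtain ⟨τ, hτ, hτT⟩ := exists_rademacherTypeIneq_of_rademacherTypeConst_lt
    (h.trans_lt ((ENNReal.ofReal_lt_ofReal_iff (by positivity)).mpr (by linarith : T < 2 * T)))
  refine (hτ.eLpNorm_integral_sub_sampleMean_le hV ⟨hr.1.le, hr.2⟩ hrq hZ hZV h_indep h_ident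
    hM).trans ?_
  rw [one_div, one_div, (Real.HolderConjugate.conjExponent hr.1).inv_sub_one,
    show 4 * kahaneConst q * T = 2 * kahaneConst q * (2 * T) by ring]
  gcongr

lemma TypeConstGrowth.eLpNorm_integral_sub_sampleMean_le {V : ℕ → Submodule ℝ E}
    {p a₀ a₁ β Cτ Cβ : ℝ} (h : TypeConstGrowth V p a₀ a₁ Cτ) (hCτ : 0 < Cτ)
    (hr : r ∈ Set.Icc p 2 ∩ Set.Ioc 1 2) (hrq : r ≤ q) {ℓ : ℕ} (hℓ : 1 ≤ ℓ)
    [FiniteDimensional ℝ (V ℓ)] (hN : 0 < Module.finrank ℝ (V ℓ)) {Z : Ω → E} {ζ : ℕ → Ω → E}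
    (hZ : Integrable Z P) (hZV : ∀ᵐ ω ∂P, Z ω ∈ V ℓ)
    (hZβ : eLpNorm (fun ω => Z ω - ∫ ω', Z ω' ∂P) (.ofReal q) P ≤
      .ofReal (Cβ * (Module.finrank ℝ (V ℓ) : ℝ) ^ (-β)))
    (h_indep : iIndepFun ζ P) (h_ident : ∀ j, IdentDistrib (ζ j) Z P P) {M : ℕ} (hM : 0 < M) :
    eLpNorm (fun ω => (∫ ω', Z ω' ∂P) - (1 / (M : ℝ)) • ∑ j ∈ Finset.range M, ζ j ω)
        (.ofReal q) P ≤
      .ofReal (4 * kahaneConst q * Cτ ^ (1 / r.conjExponent) * Cβ *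
        (Module.finrank ℝ (V ℓ) : ℝ) ^ (-(β + a₁ - a₀ / r.conjExponent)) *
          (M : ℝ) ^ (-(1 / r.conjExponent))) := by
  have hk := kahaneConst_pos (show 0 < q by linarith [hr.2.1])
  have hN' : (0 : ℝ) < Module.finrank ℝ (V ℓ) := by exact_mod_cast hN
  refine (eLpNorm_integral_sub_sampleMean_le_of_rademacherTypeConst_le
    (h.rademacherTypeConst_le hCτ hr hℓ hN) (by positivity) (V ℓ).closed_of_finiteDimensional
    hr.2 hrq hZ hZV h_indep h_ident hM).trans ?_
  grw [hZβ]
  rw [← ENNReal.ofReal_mul (by positivity)]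
  refine (congrArg _ ?_).le
  rw [show -(β + a₁ - a₀ / r.conjExponent) = a₀ / r.conjExponent - a₁ + -β by ring,
    Real.rpow_add hN']
  ring

lemma TypeConstGrowth.eLpNorm_integral_sub_sampleMean_sub_pred_le {V : ℕ → Submodule ℝ E}
    {p a₀ a₁ β Cτ Cβ c₁ c₂ a : ℝ} (h : TypeConstGrowth V p a₀ a₁ Cτ) (hCτ : 0 < Cτ) (hCβ : 0 < Cβ)
    (hr : r ∈ Set.Icc p 2 ∩ Set.Ioc 1 2) (hrq : r ≤ q) {ℓ : ℕ} (hℓ : 1 ≤ ℓ)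
    [FiniteDimensional ℝ (V ℓ)] (hc₁ : 0 < c₁) (ha : 0 < a)
    (hN : c₁ * a ≤ Module.finrank ℝ (V ℓ) ∧ Module.finrank ℝ (V ℓ) ≤ c₂ * a)
    (hV : ∀ ℓ, 1 ≤ ℓ → V ℓ ≤ V (ℓ + 1)) (hY₀ : Y 0 = 0) (hY : ∀ ℓ, Integrable (Y ℓ) P)
    (hYV : ∀ ℓ, 1 ≤ ℓ → ∀ᵐ ω ∂P, Y ℓ ω ∈ V ℓ)
    (hYβ : eLpNorm (fun ω => Y ℓ ω - (∫ ω', Y ℓ ω' ∂P) -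
      (Y (ℓ - 1) ω - ∫ ω', Y (ℓ - 1) ω' ∂P)) (.ofReal q) P ≤
        .ofReal (Cβ * (Module.finrank ℝ (V ℓ) : ℝ) ^ (-β)))
    {ζ : ℕ → Ω → E} (h_indep : iIndepFun ζ P)
    (h_ident : ∀ j, IdentDistrib (ζ j) (fun ω => Y ℓ ω - Y (ℓ - 1) ω) P P) {M : ℕ} (hM : 0 < M) :
    eLpNorm (fun ω => (∫ ω', (Y ℓ ω' - Y (ℓ - 1) ω') ∂P) -
        (1 / (M : ℝ)) • ∑ j ∈ Finset.range M, ζ j ω) (.ofReal q) P ≤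
      .ofReal (4 * kahaneConst q * Cτ ^ (1 / r.conjExponent) * Cβ *
        (c₁ ^ (-(β + a₁ - a₀ / r.conjExponent)) + c₂ ^ (-(β + a₁ - a₀ / r.conjExponent))) *
          a ^ (-(β + a₁ - a₀ / r.conjExponent)) * (M : ℝ) ^ (-(1 / r.conjExponent))) := by
  have hk := kahaneConst_pos (show 0 < q by linarith [hr.2.1])
  have hN₀ : 0 < Module.finrank ℝ (V ℓ) := Nat.cast_pos.mp ((mul_pos hc₁ ha).trans_le hN.1)
  have hZβ : eLpNorm (fun ω => Y ℓ ω - Y (ℓ - 1) ω - ∫ ω', (Y ℓ ω' - Y (ℓ - 1) ω') ∂P)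
      (.ofReal q) P ≤ .ofReal (Cβ * (Module.finrank ℝ (V ℓ) : ℝ) ^ (-β)) := by
    simpa only [integral_sub (hY ℓ) (hY (ℓ - 1)), sub_sub_sub_comm] using hYβ
  refine (h.eLpNorm_integral_sub_sampleMean_le hCτ hr hrq hℓ hN₀ ((hY ℓ).sub (hY (ℓ - 1)))
    (ae_sub_pred_mem hV hY₀ hYV hℓ) hZβ h_indep h_ident hM).trans ?_
  rw [mul_assoc _ (_ + _)]
  gcongr
  exact rpow_le_add_mul_rpow hc₁ ha hN _

end Estimator

theorem mainTheorem3_general (p q α β γ a₀ a₁ A Cτ Cα Cβ Cγ c₁ c₂ : ℝ)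
    (hp : p ∈ Set.Icc (1 : ℝ) 2) (hq : 1 < q) (hpq : p ≤ q)
    (hα : 0 < α) (hγ : 0 < γ) (hb : 0 < β + a₁) (hA : 1 < A)
    (hCτ : 0 < Cτ) (hCα : 0 < Cα) (hCβ : 0 < Cβ) (hCγ : 0 < Cγ) (hc₁ : 0 < c₁) (hc₂ : 0 < c₂) :
    ∃ K : ℝ, 0 < K ∧
      ∀ (E : Type*) [NormedAddCommGroup E] [NormedSpace ℝ E] [CompleteSpace E]
        [MeasurableSpace E] [BorelSpace E]
        (Ω : Type*) [MeasurableSpace Ω] (P : Measure Ω) [IsProbabilityMeasure P]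
        (V : ℕ → Submodule ℝ E) (N : ℕ → ℕ)
        (x : E) (Y : ℕ → Ω → E) (ξ : ℕ → ℕ → Ω → E) (cost : ℕ → ℝ≥0),
        (∀ ℓ, 1 ≤ ℓ → FiniteDimensional ℝ (V ℓ)) →
        (∀ ℓ, N ℓ = Module.finrank ℝ (V ℓ)) →
        TypeConstGrowth V p a₀ a₁ Cτ →
        (∀ ℓ, 1 ≤ ℓ → V ℓ ≤ V (ℓ + 1)) →
        (∀ ℓ, 1 ≤ ℓ → c₁ * A ^ ℓ ≤ (N ℓ : ℝ) ∧ (N ℓ : ℝ) ≤ c₂ * A ^ ℓ) →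
        Y 0 = 0 →
        (∀ ℓ, 1 ≤ ℓ → MemLp (Y ℓ) (ENNReal.ofReal q) P ∧ ∀ᵐ ω ∂P, Y ℓ ω ∈ V ℓ) →
        (∀ ℓ, 1 ≤ ℓ → ‖x - ∫ ω, Y ℓ ω ∂P‖ ≤ Cα * (N ℓ : ℝ) ^ (-α)) →
        (∀ ℓ, 1 ≤ ℓ →
          eLpNorm (fun ω => Y ℓ ω - (∫ ω', Y ℓ ω' ∂P)
              - (Y (ℓ - 1) ω - ∫ ω', Y (ℓ - 1) ω' ∂P)) (ENNReal.ofReal q) P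
            ≤ ENNReal.ofReal (Cβ * (N ℓ : ℝ) ^ (-β))) →
        (∀ ℓ, 1 ≤ ℓ → (cost ℓ : ℝ) ≤ Cγ * (N ℓ : ℝ) ^ γ) →
        (∀ ℓ, 1 ≤ ℓ → iIndepFun (ξ ℓ) P ∧
          ∀ j, IdentDistrib (ξ ℓ j) (fun ω => Y ℓ ω - Y (ℓ - 1) ω) P P) →
        ∀ ε ∈ Set.Ioc (0 : ℝ) (1 / 2),
          ∃ (L : ℕ) (M : ℕ → ℕ), 1 ≤ L ∧ (∀ ℓ ∈ Finset.Icc 1 L, 1 ≤ M ℓ) ∧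
            eLpNorm (fun ω => x - mlmcEstimator ξ L M ω) (ENNReal.ofReal q) P
              < ENNReal.ofReal ε ∧
            mlmcCost cost L M ≤ K * mlmcRate p q α β γ a₀ a₁ A ε := by
  have hk := kahaneConst_pos (zero_lt_one.trans hq)
  set r := optimalTypeExponent p q α (β + a₁) ((γ + a₀) / (β + a₁))
  have hr : r ∈ Set.Icc p (min q 2) := optimalTypeExponent_mem_Icc hp hq hpq
  obtain ⟨hrq, hr₂⟩ := le_min_iff.mp hr.2
  have hr_one : 1 < r := one_lt_optimalTypeExponent hp.1 hq
  set s := r.conjExponent with hs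
  have hs_pos : 0 < s := (Real.HolderConjugate.conjExponent hr_one).symm.pos
  set κ := β + a₁ - a₀ / s with hκ
  let m : MultilevelModel :=
    { A, α, κ, γ, s
      H₁ := Cα * (c₁ ^ (-α) + c₂ ^ (-α))
      H₂ := 4 * kahaneConst q * Cτ ^ (1 / s) * Cβ * (c₁ ^ (-κ) + c₂ ^ (-κ))
      G := Cγ * (c₁ ^ γ + c₂ ^ γ)
      one_lt_A := hA, α_pos := hα, γ_pos := hγ, s_pos := hs_pos
      H₁_pos := by positivity, H₂_pos := by positivity, G_pos := by positivity }
  obtain ⟨K, hK, h_model⟩ := m.hasCostRate_mlmcRate (p := p) hq hb hκ hs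
  refine ⟨K, hK, fun E _ _ _ _ _ Ω _ P _ V N x Y ξ cost hV_fin hN hV_type hV_mono hNA hY₀ hY
    h_bias h_var h_cost hξ ε hε => ?_⟩
  obtain ⟨L, M, hL, hM, h_error_lt, h_cost_le⟩ := h_model ε hε
  have hY_int : ∀ ℓ, Integrable (Y ℓ) P
    | 0 => hY₀ ▸ integrable_zero ..
    | ℓ + 1 => (hY (ℓ + 1) (by lia)).1.integrable (by simpa using hq.le)
  have hN_rpow (e : ℝ) {C : ℝ} (hC : 0 < C) {ℓ : ℕ} (hℓ : 1 ≤ ℓ) :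
      C * (N ℓ : ℝ) ^ e ≤ C * (c₁ ^ e + c₂ ^ e) * (A ^ ℓ) ^ e := by
    grw [rpow_le_add_mul_rpow hc₁ (by positivity) (hNA ℓ hℓ), mul_assoc]
  have h_level : ∀ ℓ ∈ Finset.Icc 1 L,
      eLpNorm (fun ω => (∫ ω', (Y ℓ ω' - Y (ℓ - 1) ω') ∂P) -
        (1 / (M ℓ : ℝ)) • ∑ j ∈ Finset.range (M ℓ), ξ ℓ j ω) (.ofReal q) P ≤
          .ofReal (m.H₂ * (A ^ ℓ) ^ (-κ) * (M ℓ : ℝ) ^ (-(1 / s))) := by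
    intro ℓ hℓ
    have hℓ₁ := (Finset.mem_Icc.mp hℓ).1
    have := hV_fin ℓ hℓ₁
    exact hV_type.eLpNorm_integral_sub_sampleMean_sub_pred_le hCτ hCβ
      ⟨⟨hr.1, hr₂⟩, hr_one, hr₂⟩ hrq hℓ₁ hc₁ (by positivity) (hN ℓ ▸ hNA ℓ hℓ₁) hV_mono hY₀ hY_int
      (fun k hk => (hY k hk).2) (hN ℓ ▸ h_var ℓ hℓ₁) (hξ ℓ hℓ₁).1 (hξ ℓ hℓ₁).2 (hM ℓ hℓ)
  refine ⟨L, M, hL, hM, (m.eLpNorm_sub_mlmcEstimator_le (by simpa using hq.le) hY₀ hY_int ?_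
    ((h_bias L hL).trans (hN_rpow (-α) hCα hL)) h_level).trans_lt
      ((ENNReal.ofReal_lt_ofReal_iff hε.1).mpr h_error_lt), ?_⟩
  · exact fun ℓ hℓ j => ((hξ ℓ (Finset.mem_Icc.mp hℓ).1).2 j).aestronglyMeasurable_iff.mpr
      ((hY_int ℓ).1.sub (hY_int (ℓ - 1)).1)
  · refine le_trans (Finset.sum_le_sum fun ℓ hℓ => ?_) h_cost_le
    grw [h_cost ℓ (Finset.mem_Icc.mp hℓ).1, hN_rpow γ hCγ (Finset.mem_Icc.mp hℓ).1]

theorem mainTheorem3 (p q α β γ a₀ a₁ A Cτ Cα Cβ Cγ c₁ c₂ : ℝ)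
    (hp : p ∈ Set.Icc (1 : ℝ) 2) (hq : 1 < q) (hpq : p ≤ q)
    (hα : 0 < α) (hβ : 0 < β) (hγ : 0 < γ) (ha₀ : 0 ≤ a₀) (ha₁ : 0 ≤ a₁) (hA : 1 < A)
    (hCτ : 1 ≤ Cτ) (hCα : 0 < Cα) (hCβ : 0 < Cβ) (hCγ : 0 < Cγ) (hc₁ : 0 < c₁) (hc₂ : 0 < c₂) :
    -- the implied constant depends only on the numerical parameters above
    ∃ K : ℝ, 0 < K ∧
      ∀ (E : Type*) [NormedAddCommGroup E] [NormedSpace ℝ E] [CompleteSpace E]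
        [MeasurableSpace E] [BorelSpace E]
        (Ω : Type*) [MeasurableSpace Ω] (P : Measure Ω) [IsProbabilityMeasure P]
        -- the subspaces `E_ℓ` (`ℓ ≥ 1`) of dimension `N_ℓ`
        (V : ℕ → Submodule ℝ E) (N : ℕ → ℕ)
        -- `X`, its approximations `X_ℓ`, the samples `ξ_{ℓ,j}` and the costs per sample
        (X : Ω → E) (Y : ℕ → Ω → E) (ξ : ℕ → ℕ → Ω → E) (cost : ℕ → ℝ≥0),
        HasRademacherType E p →
        (∀ ℓ, 1 ≤ ℓ → FiniteDimensional ℝ (V ℓ)) →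
        (∀ ℓ, N ℓ = Module.finrank ℝ (V ℓ)) →
        TypeConstGrowth V p a₀ a₁ Cτ →
        (∀ ℓ, 1 ≤ ℓ → V ℓ ≤ V (ℓ + 1)) →
        (∀ ℓ, 1 ≤ ℓ → c₁ * A ^ ℓ ≤ (N ℓ : ℝ) ∧ (N ℓ : ℝ) ≤ c₂ * A ^ ℓ) →
        Integrable X P →
        Y 0 = 0 →
        (∀ ℓ, 1 ≤ ℓ → MemLp (Y ℓ) (ENNReal.ofReal q) P ∧ ∀ᵐ ω ∂P, Y ℓ ω ∈ V ℓ) →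
        (∀ ℓ, 1 ≤ ℓ → ‖(∫ ω, X ω ∂P) - ∫ ω, Y ℓ ω ∂P‖ ≤ Cα * (N ℓ : ℝ) ^ (-α)) →
        (∀ ℓ, 1 ≤ ℓ →
          eLpNorm (fun ω => Y ℓ ω - (∫ ω', Y ℓ ω' ∂P)
              - (Y (ℓ - 1) ω - ∫ ω', Y (ℓ - 1) ω' ∂P)) (ENNReal.ofReal q) P
            ≤ ENNReal.ofReal (Cβ * (N ℓ : ℝ) ^ (-β))) →
        (∀ ℓ, 1 ≤ ℓ → (cost ℓ : ℝ) ≤ Cγ * (N ℓ : ℝ) ^ γ) →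
        -- for each level, `ξ_{ℓ,j}` are independent copies of `X_ℓ - X_{ℓ-1}`
        (∀ ℓ, 1 ≤ ℓ → iIndepFun (ξ ℓ) P ∧
          ∀ j, IdentDistrib (ξ ℓ j) (fun ω => Y ℓ ω - Y (ℓ - 1) ω) P P) →
        ∀ ε ∈ Set.Ioc (0 : ℝ) (1 / 2),
          ∃ (L : ℕ) (M : ℕ → ℕ), 1 ≤ L ∧ (∀ ℓ ∈ Finset.Icc 1 L, 1 ≤ M ℓ) ∧
            eLpNorm (fun ω => (∫ ω', X ω' ∂P) - mlmcEstimator ξ L M ω) (ENNReal.ofReal q) P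
              < ENNReal.ofReal ε ∧
            mlmcCost cost L M ≤ K * mlmcRate p q α β γ a₀ a₁ A ε := by
  obtain ⟨K, hK, h_general⟩ := mainTheorem3_general p q α β γ a₀ a₁ A Cτ Cα Cβ Cγ c₁ c₂ hp hq hpq
    hα hγ (by linarith) hA (by linarith) hCα hCβ hCγ hc₁ hc₂
  exact ⟨K, hK, fun E _ _ _ _ _ Ω _ P _ V N X Y ξ cost _ hV_fin hN hV_type hV_mono hNA _ =>
    h_general E Ω P V N (∫ ω, X ω ∂P) Y ξ cost hV_fin hN hV_type hV_mono hNA⟩
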